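/- Let $n\ge 0$ be an integer. Let $C^\infty_0(\mathbb R^n)$ be the $\mathbb R$-algebra of germs at the origin of $C^\infty$ functions $\mathbb R^n\to\mathbb R$, and for $f\in C^\infty_0(\mathbb R^n)$ let $J_{\mathbb R}(f)$ be the ideal of $C^\infty_0(\mathbb R^n)$ generated by the partial derivatives $f'_{x_1},\dots,f'_{x_n}$; the real Milnor number of $f$ is $\mu_{\mathbb R}(f)=\dim_{\mathbb R}\bigl(C^\infty_0(\mathbb R^n)/J_{\mathbb R}(f)\bigr)$. Let $\mathcal O_n$ be the $\mathbb C$-algebra of germs at the origin of holomorphic functions on $\mathbb C^n$, $\mathfrak m=\{F\in\mathcal O_n : F(0)=0\}$, and for $F\in\mathcal O_n$ let $J_{\mathbb C}(F)$ be the ideal of $\mathcal O_n$ generated by $F'_{z_1},\dots,F'_{z_n}$. Let $f\in C^\infty_0(\mathbb R^n)$ be a real-analytic germ, i.e. given near the origin by a convergent power series with real coefficients (for instance a polynomial), and let $F\in\mathcal O_n$ be the germ given by the same series in complex variables. Suppose that at least one of the following conditions holds: - $(\mu1)$ there is $m\ge1$ such that $z_i^m\in J_{\mathbb C}(F)$ for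 every $i=1,\dots,n$; - $(\mu2)$ there is $p\ge1$ such that $z_1^{a_1}\cdots z_n^{a_n}\in J_{\mathbb C}(F)$ whenever $a_1+\cdots+a_n\ge p$; - $(\mu3)$ there is $p\ge1$ such that $\mathfrak m^p\subset J_{\mathbb C}(F)$; - $(\mu4)$ $0\in\mathbb C^n$ is an isolated critical point of $F$, in the sense that some punctured neighbourhood of $0$ contains no critical points of $F$ (whether or not $0$ itself is critical); - $(\mu5)$ $\dim_{\mathbb C}\bigl(\mathcal O_n/J_{\mathbb C}(F)\bigr)<\infty$. Then $\mu_{\mathbb R}(f)<\infty$. -/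

import Mathlib

open Filter
open scoped Topology ContDiff

noncomputable section

namespace GermMilnor

/-- Germs of scalar functions form an algebra over the scalars. -/
instance germAlgebra {X R : Type*} [CommSemiring R] (l : Filter X) : Algebra R (Germ l R) :=
  Algebra.ofModule
    (fun r φ ψ => Germ.inductionOn₂ φ ψ fun f g =>
      congrArg Germ.ofFun (funext fun x => mul_assoc r (f x) (g x)))
    (fun r φ ψ => Germ.inductionOn₂ φ ψ fun f g =>
      congrArg Germ.ofFun (funext fun x => mul_left_comm (f x) r (g x)))

theorem algebraMap_germ {X R : Type*} [CommSemiring R] (l : Filter X) (r : R) :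
    algebraMap R (Germ l R) r = ((fun _ => r : X → R) : Germ l R) :=
  congrArg Germ.ofFun (funext fun _ => mul_one r)

/-! ### Partial derivatives of germs at the origin -/

section Partial

variable {𝕜 : Type*} [NontriviallyNormedField 𝕜] {n : ℕ}

/-- The `i`-th partial derivative of a function of `n` variables. -/
def partialFun (i : Fin n) (g : (Fin n → 𝕜) → 𝕜) : (Fin n → 𝕜) → 𝕜 :=
  fun x => fderiv 𝕜 g x (Pi.single i 1)

theorem partialFun_congr (i : Fin n) {g h : (Fin n → 𝕜) → 𝕜} {x : Fin n → 𝕜}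
    (H : g =ᶠ[𝓝 x] h) : partialFun i g =ᶠ[𝓝 x] partialFun i h := by
  filter_upwards [H.fderiv (𝕜 := 𝕜)] with y hy
  simp only [partialFun, hy]

/-- The `i`-th partial derivative of a germ at the origin. -/
def germPartial (i : Fin n) :
    Germ (𝓝 (0 : Fin n → 𝕜)) 𝕜 → Germ (𝓝 (0 : Fin n → 𝕜)) 𝕜 :=
  Germ.map' (partialFun i) fun _ _ H => partialFun_congr i H

@[simp] theorem germPartial_coe (i : Fin n) (g : (Fin n → 𝕜) → 𝕜) :
    germPartial i (g : Germ (𝓝 (0 : Fin n → 𝕜)) 𝕜) = (partialFun i g : Germ _ _) := rfl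

end Partial

/-! ### Germs of smooth functions at the origin of `ℝⁿ` -/

/-- The algebra of germs at the origin of `C^∞` functions on `ℝⁿ`: germs of functions that are
`C^∞` in a neighbourhood of the origin (equivalently, of `C^∞` functions defined on the whole of
`ℝⁿ`, see `mem_smoothGerms_iff`). -/
def smoothGerms (n : ℕ) : Subalgebra ℝ (Germ (𝓝 (0 : Fin n → ℝ)) ℝ) where
  carrier := {φ | ∃ g : (Fin n → ℝ) → ℝ, (∀ᶠ x in 𝓝 0, ContDiffAt ℝ ∞ g x) ∧ φ = (g : Germ _ _)}
  mul_mem' := by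
    rintro _ _ ⟨g, hg, rfl⟩ ⟨h, hh, rfl⟩
    exact ⟨g * h, (hg.and hh).mono fun x hx => hx.1.mul hx.2, rfl⟩
  add_mem' := by
    rintro _ _ ⟨g, hg, rfl⟩ ⟨h, hh, rfl⟩
    exact ⟨g + h, (hg.and hh).mono fun x hx => hx.1.add hx.2, rfl⟩
  algebraMap_mem' r := ⟨fun _ => r, Eventually.of_forall fun _ => contDiffAt_const,
    algebraMap_germ _ r⟩

theorem mem_smoothGerms_iff {n : ℕ} (φ : Germ (𝓝 (0 : Fin n → ℝ)) ℝ) :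
    φ ∈ smoothGerms n ↔ ∃ g : (Fin n → ℝ) → ℝ, ContDiff ℝ ∞ g ∧ φ = (g : Germ _ _) := by
  constructor
  · rintro ⟨g, hg, rfl⟩
    obtain ⟨r, hr, hball⟩ := Metric.eventually_nhds_iff.1 hg
    let b : ContDiffBump (0 : Fin n → ℝ) := ⟨r / 3, r / 2, by positivity, by linarith⟩
    refine ⟨fun x => b x * g x, ?_, ?_⟩
    · refine contDiff_iff_contDiffAt.2 fun x => ?_
      by_cases hx : dist x 0 < r
      · exact b.contDiff.contDiffAt.mul (hball hx)
      · have h0 : (fun x => b x * g x) =ᶠ[𝓝 x] fun _ => 0 := by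
          have : {y : Fin n → ℝ | r / 2 < dist y 0} ∈ 𝓝 x :=
            (isOpen_lt continuous_const (continuous_id.dist continuous_const)).mem_nhds
              (show r / 2 < dist x 0 by linarith)
          filter_upwards [this] with y hy
          rw [b.zero_of_le_dist (le_of_lt hy), zero_mul]
        exact contDiffAt_const.congr_of_eventuallyEq h0
    · refine Germ.coe_eq.2 ?_
      filter_upwards [b.eventuallyEq_one] with y hy
      simp [hy]
  · rintro ⟨g, hg, rfl⟩
    exact ⟨g, Eventually.of_forall fun x => hg.contDiffAt, rfl⟩

theorem germPartial_mem_smoothGerms {n : ℕ} (i : Fin n) {φ : Germ (𝓝 (0 : Fin n → ℝ)) ℝ}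
    (hφ : φ ∈ smoothGerms n) : germPartial i φ ∈ smoothGerms n := by
  obtain ⟨g, hg, rfl⟩ := hφ
  refine ⟨partialFun i g, hg.mono fun x hx => ?_, rfl⟩
  exact (hx.fderiv_right (m := ∞) (by simp)).clm_apply contDiffAt_const

/-- The partial derivative as an operation on germs of smooth functions. -/
def smoothPartial {n : ℕ} (i : Fin n) (f : smoothGerms n) : smoothGerms n :=
  ⟨germPartial i f, germPartial_mem_smoothGerms i f.2⟩

/-- The ideal generated by the partial derivatives in the algebra of smooth germs. -/
def realJacobiIdeal {n : ℕ} (f : smoothGerms n) : Ideal (smoothGerms n) :=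
  Ideal.span (Set.range fun i => smoothPartial i f)

/-- The real Milnor number: the dimension over `ℝ` of the algebra of smooth germs modulo the
Jacobi ideal, as a cardinal. -/
def realMilnorNumber {n : ℕ} (f : smoothGerms n) : Cardinal :=
  Module.rank ℝ (smoothGerms n ⧸ realJacobiIdeal f)

/-- A smooth germ is analytic if it is represented near the origin by a convergent power series. -/
def IsAnalyticGerm {n : ℕ} (f : smoothGerms n) : Prop :=
  ∃ g : (Fin n → ℝ) → ℝ, AnalyticAt ℝ g 0 ∧ (f : Germ (𝓝 (0 : Fin n → ℝ)) ℝ) = (g : Germ _ _)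

/-! ### Germs of holomorphic functions at the origin of `ℂⁿ` -/

/-- The algebra of germs at the origin of holomorphic functions on `ℂⁿ`. -/
def holoGerms (n : ℕ) : Subalgebra ℂ (Germ (𝓝 (0 : Fin n → ℂ)) ℂ) where
  carrier := {φ | ∃ g : (Fin n → ℂ) → ℂ, AnalyticAt ℂ g 0 ∧ φ = (g : Germ _ _)}
  mul_mem' := by
    rintro _ _ ⟨g, hg, rfl⟩ ⟨h, hh, rfl⟩
    exact ⟨g * h, hg.mul hh, rfl⟩
  add_mem' := by
    rintro _ _ ⟨g, hg, rfl⟩ ⟨h, hh, rfl⟩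
    exact ⟨g + h, hg.add hh, rfl⟩
  algebraMap_mem' r := ⟨fun _ => r, analyticAt_const, algebraMap_germ _ r⟩

theorem germPartial_mem_holoGerms {n : ℕ} (i : Fin n) {φ : Germ (𝓝 (0 : Fin n → ℂ)) ℂ}
    (hφ : φ ∈ holoGerms n) : germPartial i φ ∈ holoGerms n := by
  obtain ⟨g, hg, rfl⟩ := hφ
  exact ⟨partialFun i g, ((ContinuousLinearMap.apply ℂ ℂ (Pi.single i 1 : Fin n → ℂ)).analyticAt _).comp hg.fderiv, rfl⟩

/-- The partial derivative as an operation on germs of holomorphic functions. -/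
def holoPartial {n : ℕ} (i : Fin n) (F : holoGerms n) : holoGerms n :=
  ⟨germPartial i F, germPartial_mem_holoGerms i F.2⟩

/-- The ideal generated by the partial derivatives in the algebra of holomorphic germs. -/
def complexJacobiIdeal {n : ℕ} (F : holoGerms n) : Ideal (holoGerms n) :=
  Ideal.span (Set.range fun i => holoPartial i F)

/-- The complex Milnor number: the dimension over `ℂ` of the algebra of holomorphic germs modulo
the Jacobi ideal, as a cardinal. -/
def complexMilnorNumber {n : ℕ} (F : holoGerms n) : Cardinal :=
  Module.rank ℂ (holoGerms n ⧸ complexJacobiIdeal F)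

/-- The germ of the coordinate function `z_i`. -/
def coordGerm {n : ℕ} (i : Fin n) : holoGerms n :=
  ⟨((fun z => z i : (Fin n → ℂ) → ℂ) : Germ _ _), fun z => z i,
    (ContinuousLinearMap.proj (R := ℂ) (φ := fun _ : Fin n => ℂ) i).analyticAt 0, rfl⟩

/-- The ideal of holomorphic germs that vanish at the origin. -/
def maxId (n : ℕ) : Ideal (holoGerms n) :=
  RingHom.ker ((Germ.valueRingHom : Germ (𝓝 (0 : Fin n → ℂ)) ℂ →+* ℂ).comp (holoGerms n).subtype)

/-- Some `m ≥ 1` has `z_i ^ m` in the Jacobi ideal for every `i`. -/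
def Mu1 {n : ℕ} (F : holoGerms n) : Prop :=
  ∃ m : ℕ, 1 ≤ m ∧ ∀ i : Fin n, coordGerm i ^ m ∈ complexJacobiIdeal F

/-- Some `p ≥ 1` has all monomials of degree at least `p` in the Jacobi ideal. -/
def Mu2 {n : ℕ} (F : holoGerms n) : Prop :=
  ∃ p : ℕ, 1 ≤ p ∧ ∀ a : Fin n → ℕ, p ≤ ∑ i, a i →
    ∏ i, coordGerm i ^ a i ∈ complexJacobiIdeal F

/-- Some `p ≥ 1` has the `p`-th power of the maximal ideal inside the Jacobi ideal. -/
def Mu3 {n : ℕ} (F : holoGerms n) : Prop :=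
  ∃ p : ℕ, 1 ≤ p ∧ maxId n ^ p ≤ complexJacobiIdeal F

/-- The origin is an isolated critical point: some punctured neighbourhood of the origin contains
no critical points. A germ for which the origin is not critical at all also satisfies this. -/
def Mu4 {n : ℕ} (F : holoGerms n) : Prop :=
  ∃ g : (Fin n → ℂ) → ℂ, (F : Germ (𝓝 (0 : Fin n → ℂ)) ℂ) = (g : Germ _ _) ∧
    ∀ᶠ z in 𝓝[≠] (0 : Fin n → ℂ), fderiv ℂ g z ≠ 0

/-- The complex Milnor number is finite. -/
def Mu5 {n : ℕ} (F : holoGerms n) : Prop :=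
  complexMilnorNumber F < Cardinal.aleph0

/-! ### A real power series regarded as a complex one -/

/-- The power series on `ℂⁿ` with the same (real) coefficients as the given series on `ℝⁿ`: the
term of degree `k` is
`(z₁, …, z_k) ↦ ∑ (i₁, …, i_k), p_k (e_{i₁}, …, e_{i_k}) * (z₁)_{i₁} * ⋯ * (z_k)_{i_k}`. -/
def complexifySeries {n : ℕ} (p : FormalMultilinearSeries ℝ (Fin n → ℝ) ℝ) :
    FormalMultilinearSeries ℂ (Fin n → ℂ) ℂ := fun k =>
  ∑ i : Fin k → Fin n, (p k (fun j => Pi.single (i j) 1) : ℂ) •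
    (ContinuousMultilinearMap.mkPiAlgebra ℂ (Fin k) ℂ).compContinuousLinearMap
      (fun j => ContinuousLinearMap.proj (R := ℂ) (φ := fun _ : Fin n => ℂ) (i j))

theorem complexifySeries_apply {n : ℕ} (p : FormalMultilinearSeries ℝ (Fin n → ℝ) ℝ) (k : ℕ)
    (z : Fin k → Fin n → ℂ) : complexifySeries p k z =
      ∑ i : Fin k → Fin n, (p k (fun j => Pi.single (i j) 1) : ℂ) * ∏ j, z j (i j) := by
  simp [complexifySeries]

theorem norm_complexifySeries_le {n : ℕ} (p : FormalMultilinearSeries ℝ (Fin n → ℝ) ℝ) (k : ℕ) :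
    ‖complexifySeries p k‖ ≤ (n : ℝ) ^ k * ‖p k‖ := by
  refine ContinuousMultilinearMap.opNorm_le_bound (by positivity) fun z => ?_
  rw [complexifySeries_apply]
  calc _ ≤ ∑ i : Fin k → Fin n, ‖p k‖ * ∏ j, ‖z j‖ := by
        refine norm_sum_le_of_le _ fun i _ => ?_
        rw [norm_mul, norm_prod, Complex.norm_real]
        gcongr
        · refine ((p k).le_opNorm _).trans (mul_le_of_le_one_right (norm_nonneg _) ?_)
          exact Finset.prod_le_one (fun _ _ => norm_nonneg _) fun j _ => by simp [Pi.norm_single]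
        · exact norm_le_pi_norm _ _
    _ = _ := by simp [mul_assoc]

theorem radius_complexifySeries_pos {n : ℕ} {p : FormalMultilinearSeries ℝ (Fin n → ℝ) ℝ}
    (hp : 0 < p.radius) : 0 < (complexifySeries p).radius := by
  obtain ⟨C, r, hC, hr, h⟩ := p.le_mul_pow_of_radius_pos hp
  let s : NNReal := ⟨((n + 1) * r)⁻¹, by positivity⟩
  have hs : (0 : ENNReal) < s := by
    rw [ENNReal.coe_pos, ← NNReal.coe_pos]
    change (0 : ℝ) < ((n + 1) * r)⁻¹
    positivity
  refine hs.trans_le (FormalMultilinearSeries.le_radius_of_bound _ C fun k => ?_)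
  change _ * (((n + 1) * r)⁻¹ : ℝ) ^ k ≤ C
  calc _ ≤ ((n : ℝ) ^ k * (C * r ^ k)) * (((n + 1) * r)⁻¹ : ℝ) ^ k := by
        gcongr
        exact (norm_complexifySeries_le p k).trans (by gcongr; exact h k)
    _ = C * ((n : ℝ) / (n + 1)) ^ k := by
        rw [inv_pow, mul_pow, div_pow]; field_simp
    _ ≤ C := mul_le_of_le_one_right hC.le (pow_le_one₀ (by positivity)
        (div_le_one_of_le₀ (by linarith) (by positivity)))

theorem complexifySeries_ofReal {n : ℕ} (p : FormalMultilinearSeries ℝ (Fin n → ℝ) ℝ) (k : ℕ)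
    (x : Fin n → ℝ) : complexifySeries p k (fun _ i => (x i : ℂ)) = (p k fun _ => x : ℝ) := by
  have hx : x = ∑ i, x i • (Pi.single i 1 : Fin n → ℝ) := by
    ext j; simp [Finset.sum_apply, Pi.single_apply]
  have : (p k fun _ => x) =
      ∑ i : Fin k → Fin n, p k (fun j => Pi.single (i j) 1) * ∏ j, x (i j) := by
    conv_lhs => rw [hx]
    rw [ContinuousMultilinearMap.map_sum (p k)
      (g := fun _ i => x i • (Pi.single i 1 : Fin n → ℝ))]
    refine Finset.sum_congr rfl fun i _ => ?_
    rw [ContinuousMultilinearMap.map_smul_univ, smul_eq_mul, mul_comm]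
  rw [complexifySeries_apply, this]
  push_cast
  rfl

theorem IsAnalyticGerm.exists_series {n : ℕ} {f : smoothGerms n} (hf : IsAnalyticGerm f) :
    ∃ p : FormalMultilinearSeries ℝ (Fin n → ℝ) ℝ, ∃ g : (Fin n → ℝ) → ℝ,
      HasFPowerSeriesAt g p 0 ∧ (f : Germ (𝓝 (0 : Fin n → ℝ)) ℝ) = (g : Germ _ _) := by
  obtain ⟨g, ⟨p, hp⟩, h⟩ := hf
  exact ⟨p, g, hp, h⟩

/-- A power series of an analytic germ. -/
def IsAnalyticGerm.series {n : ℕ} {f : smoothGerms n} (hf : IsAnalyticGerm f) :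
    FormalMultilinearSeries ℝ (Fin n → ℝ) ℝ := hf.exists_series.choose

/-- An analytic germ at the origin of `ℝⁿ`, regarded as a holomorphic germ at the origin of `ℂⁿ`:
the sum of the complex power series with the same real coefficients. -/
def IsAnalyticGerm.complexification {n : ℕ} {f : smoothGerms n} (hf : IsAnalyticGerm f) :
    holoGerms n :=
  ⟨((complexifySeries hf.series).sum : Germ _ _), (complexifySeries hf.series).sum, by
    obtain ⟨g, hg, -⟩ := hf.exists_series.choose_spec
    exact ((complexifySeries hf.series).hasFPowerSeriesOnBall
      (radius_complexifySeries_pos hg.radius_pos)).analyticAt, rfl⟩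

/-- The complexification of an analytic germ restricts to that germ on `ℝⁿ`. -/
theorem IsAnalyticGerm.complexification_ofReal {n : ℕ} {f : smoothGerms n}
    (hf : IsAnalyticGerm f) {F : (Fin n → ℂ) → ℂ} {g : (Fin n → ℝ) → ℝ}
    (hF : (hf.complexification : Germ (𝓝 (0 : Fin n → ℂ)) ℂ) = (F : Germ _ _))
    (hg : (f : Germ (𝓝 (0 : Fin n → ℝ)) ℝ) = (g : Germ _ _)) :
    ∀ᶠ x : Fin n → ℝ in 𝓝 0, F (fun i => (x i : ℂ)) = (g x : ℂ) := by
  obtain ⟨g', hg', hfg'⟩ := hf.exists_series.choose_spec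
  have h1 : (complexifySeries hf.series).sum =ᶠ[𝓝 0] F := Germ.coe_eq.1 hF
  have h2 : g =ᶠ[𝓝 0] g' := Germ.coe_eq.1 (hg.symm.trans hfg')
  have hc : Tendsto (fun x : Fin n → ℝ => fun i => (x i : ℂ)) (𝓝 0) (𝓝 0) := by
    have : Continuous (fun x : Fin n → ℝ => fun i => (x i : ℂ)) := by fun_prop
    have h := this.tendsto 0
    have h0 : (fun i => ((0 : Fin n → ℝ) i : ℂ)) = (0 : Fin n → ℂ) := by ext; simp
    rwa [h0] at h
  filter_upwards [hc.eventually h1, h2, hg'.eventually_hasSum] with x hx1 hx2 hx3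
  rw [← hx1, hx2]
  rw [zero_add] at hx3
  have h4 := (Complex.hasSum_ofReal.2 hx3).tsum_eq
  rw [← h4]
  exact tsum_congr fun k => complexifySeries_ofReal hf.series k x

end GermMilnor

end

/-!
The real Milnor number is finite as soon as some power of every coordinate `x_i` lies in the real
Jacobi ideal: by Hadamard's lemma (`smoothGerm_hadamard`) every smooth germ is a scalar plus a
combination of the coordinates, so the quotient is generated by the finitely many nilpotent classes
of the `x_i` and is finite-dimensional (`finite_quotient_of_coord_mem_radical`). A relation
`z_i ^ m = ∑ A_j F'_{z_j}` between holomorphic germs restricts to `ℝⁿ`, where the derivatives of `F`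
are real; taking real parts of the `A_j` gives `x_i ^ m ∈ J_ℝ(f)` (`realCoordGerm_mem_radical`).
It remains to see that each of the five conditions puts every `z_i` into the radical of `J_ℂ(F)`.
For the first three this is immediate, and for a finite-dimensional quotient it follows from the
Artinian property.

For an isolated critical point it is the analytic Nullstellensatz for an isolated common zero
(`isolatedNullstellensatz`), proved by induction on the number of variables. After a linear change
of coordinates some function `g_{j₀}` does not vanish identically on the first axis. Functions of
`(c, z) ∈ ℂ × ℂⁿ` are viewed as functions of `z` with values in the disc algebra `W`, the closure of
the polynomials in the continuous functions on a closed disc. Since a holomorphic function can be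
evaluated at points of `Wⁿ⁺¹`, these `W`-valued functions are analytic. At `z = 0` the function
`g_{j₀}` becomes `w ^ d` times a unit of `W`, so that `W` is the direct sum of its multiples and of
the polynomials of degree less than `d` in `w`. Invertible operators form an open set on which
inversion is analytic, hence the same decomposition holds for `z` near `0` and depends analytically
on `z`: this is Weierstrass division (`exists_analytic_division`, `IsLift.exists_division`).

Write each `g_j * w ^ i` modulo `g_{j₀}` as a polynomial in `w` of degree less than `d`. By Cramer's
rule the maximal minors of the resulting matrix, holomorphic functions of `z` alone, lie in the ideal
of the `g_j`. At a point `z ≠ 0` the `g_j` have no common zero on the disc, so by Gelfand theory they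
generate the unit ideal of `W`, and some minor is nonzero (`exists_minor_ne_zero`). Thus the minors
have an isolated common zero, and by the induction hypothesis all germs in `z` that vanish at `0` are
nilpotent modulo the ideal. Dividing `w ^ d`, and then an arbitrary germ vanishing at `0`, by
`g_{j₀}` extends this to all `n + 1` variables.
-/

noncomputable section

namespace GermMilnor

/-! ### Holomorphic functions on Banach algebras -/

section Lift

variable {n : ℕ} {W : Type*} [NormedCommRing W] [NormedAlgebra ℂ W]

/-- The power series on `Wⁿ`, for a commutative Banach algebra `W`, with the same coefficients as
the given series on `ℂⁿ`. -/
def algebraSeries (W : Type*) [NormedCommRing W] [NormedAlgebra ℂ W]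
    (p : FormalMultilinearSeries ℂ (Fin n → ℂ) ℂ) :
    FormalMultilinearSeries ℂ (Fin n → W) W := fun k =>
  ∑ i : Fin k → Fin n, p k (fun j => Pi.single (i j) 1) •
    (ContinuousMultilinearMap.mkPiAlgebra ℂ (Fin k) W).compContinuousLinearMap
      (fun j => ContinuousLinearMap.proj (R := ℂ) (φ := fun _ : Fin n => W) (i j))

theorem algebraSeries_apply (p : FormalMultilinearSeries ℂ (Fin n → ℂ) ℂ) (k : ℕ)
    (x : Fin k → Fin n → W) : algebraSeries W p k x =
      ∑ i : Fin k → Fin n, p k (fun j => Pi.single (i j) 1) • ∏ j, x j (i j) := by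
  simp [algebraSeries]

theorem norm_algebraSeries_le [NormOneClass W] (p : FormalMultilinearSeries ℂ (Fin n → ℂ) ℂ)
    (k : ℕ) :
    ‖algebraSeries W p k‖ ≤ (n : ℝ) ^ k * ‖p k‖ := by
  refine ContinuousMultilinearMap.opNorm_le_bound (by positivity) fun z => ?_
  rw [algebraSeries_apply]
  calc _ ≤ ∑ i : Fin k → Fin n, ‖p k‖ * ∏ j, ‖z j‖ := by
        refine norm_sum_le_of_le _ fun i _ => (norm_smul_le _ _).trans ?_
        gcongr
        · refine ((p k).le_opNorm _).trans (mul_le_of_le_one_right (norm_nonneg _) ?_)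
          exact Finset.prod_le_one (fun _ _ => norm_nonneg _) fun j _ => by simp [Pi.norm_single]
        · refine (Finset.norm_prod_le _ _).trans (Finset.prod_le_prod (fun _ _ => norm_nonneg _)
            fun j _ => norm_le_pi_norm _ _)
    _ = _ := by simp [mul_assoc]

theorem radius_algebraSeries_pos [NormOneClass W] {p : FormalMultilinearSeries ℂ (Fin n → ℂ) ℂ}
    (hp : 0 < p.radius) : 0 < (algebraSeries W p).radius := by
  obtain ⟨C, r, hC, hr, h⟩ := p.le_mul_pow_of_radius_pos hp
  let s : NNReal := ⟨((n + 1) * r)⁻¹, by positivity⟩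
  have hs : (0 : ENNReal) < s := by
    rw [ENNReal.coe_pos, ← NNReal.coe_pos]
    change (0 : ℝ) < ((n + 1) * r)⁻¹
    positivity
  refine hs.trans_le (FormalMultilinearSeries.le_radius_of_bound _ C fun k => ?_)
  change _ * (((n + 1) * r)⁻¹ : ℝ) ^ k ≤ C
  calc _ ≤ ((n : ℝ) ^ k * (C * r ^ k)) * (((n + 1) * r)⁻¹ : ℝ) ^ k := by
        gcongr
        exact (norm_algebraSeries_le p k).trans (by gcongr; exact h k)
    _ = C * ((n : ℝ) / (n + 1)) ^ k := by
        rw [inv_pow, mul_pow, div_pow]; field_simp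
    _ ≤ C := mul_le_of_le_one_right hC.le (pow_le_one₀ (by positivity)
        (div_le_one_of_le₀ (by linarith) (by positivity)))

theorem algHom_algebraSeries (p : FormalMultilinearSeries ℂ (Fin n → ℂ) ℂ) (k : ℕ)
    (x : Fin n → W) (φ : W →ₐ[ℂ] ℂ) :
    φ (algebraSeries W p k fun _ => x) = p k fun _ i => φ (x i) := by
  have hx : (fun i => φ (x i)) = ∑ i, φ (x i) • (Pi.single i 1 : Fin n → ℂ) := by
    ext j; simp [Finset.sum_apply, Pi.single_apply]
  conv_rhs => rw [hx]
  rw [ContinuousMultilinearMap.map_sum (p k)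
      (g := fun _ i => φ (x i) • (Pi.single i 1 : Fin n → ℂ)), algebraSeries_apply, map_sum]
  refine Finset.sum_congr rfl fun i _ => ?_
  rw [ContinuousMultilinearMap.map_smul_univ, map_smul, map_prod, smul_eq_mul, smul_eq_mul,
    mul_comm]

theorem norm_algHom_le [NormOneClass W] [CompleteSpace W] (φ : W →ₐ[ℂ] ℂ) (x : W) : ‖φ x‖ ≤ ‖x‖ := by
  simpa using AlgHom.norm_apply_le_self φ x

/-- A holomorphic function of `n` variables near the origin extends to a holomorphic function of
`n` variables in any commutative Banach algebra, compatibly with all characters. -/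
theorem exists_algebra_extension [NormOneClass W] [CompleteSpace W] {g : (Fin n → ℂ) → ℂ}
    (hg : AnalyticAt ℂ g 0) :
    ∃ G : (Fin n → W) → W, AnalyticAt ℂ G 0 ∧
      ∀ᶠ x in 𝓝 (0 : Fin n → W), ∀ φ : W →ₐ[ℂ] ℂ, φ (G x) = g fun i => φ (x i) := by
  obtain ⟨p, hp⟩ := hg
  have hG := (algebraSeries W p).hasFPowerSeriesOnBall (radius_algebraSeries_pos hp.radius_pos)
  refine ⟨(algebraSeries W p).sum, hG.analyticAt, ?_⟩
  obtain ⟨ε, hε, h⟩ := Metric.eventually_nhds_iff.1 hp.eventually_hasSum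
  filter_upwards [hG.hasFPowerSeriesAt.eventually_hasSum, Metric.ball_mem_nhds _ hε] with x hx hxε φ
  rw [zero_add] at hx
  have hφ : Continuous φ := map_continuous φ
  have h1 := hx.map (φ : W →+ ℂ) hφ
  have h2 : dist (fun i => φ (x i)) 0 < ε := by
    rw [mem_ball_zero_iff] at hxε
    rw [dist_zero_right]
    refine lt_of_le_of_lt ((pi_norm_le_iff_of_nonneg (norm_nonneg _)).2 fun i => ?_) hxε
    exact (norm_algHom_le φ _).trans (norm_le_pi_norm _ _)
  have h3 := h h2
  rw [zero_add] at h3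
  have h4 : ((φ : W →+ ℂ) ∘ fun k => algebraSeries W p k fun _ => x) =
      fun k => p k fun _ i => φ (x i) := funext fun k => algHom_algebraSeries p k x φ
  rw [h4] at h1
  exact h1.unique h3

end Lift

/-! ### The disc algebra -/

/-- The properties of the disc algebra (continuous functions on the closed unit disc, holomorphic
inside) with its coordinate `w` that Weierstrass division rests on: each element is uniquely
`c + w * h` with `c` a scalar, each point of the closed disc gives a character, and characters
separate the elements. -/
structure IsDiscAlgebra (W : Type*) [NormedCommRing W] [NormedAlgebra ℂ W] (w : W) : Prop where
  norm_le : ‖w‖ ≤ 1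
  bijective : Function.Bijective fun p : ℂ × W => algebraMap ℂ W p.1 + w * p.2
  exists_char : ∀ c : ℂ, ‖c‖ ≤ 1 → ∃ φ : W →ₐ[ℂ] ℂ, φ w = c
  eq_zero : ∀ f : W, (∀ φ : W →ₐ[ℂ] ℂ, φ f = 0) → f = 0

section DiscAlgebra

/-- The closed unit disc. -/
abbrev UnitDisc := Metric.closedBall (0 : ℂ) 1

/-- The coordinate function on the closed unit disc. -/
def discCoord : C(UnitDisc, ℂ) := ⟨fun z => z, continuous_subtype_val⟩

/-- The closure of the polynomials in the continuous functions on the closed unit disc. -/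
abbrev DiscAlgebra := Algebra.elemental ℂ discCoord

instance : NormedCommRing DiscAlgebra :=
  { (inferInstance : NormedRing DiscAlgebra) with mul_comm := mul_comm }
instance : NormedAlgebra ℂ DiscAlgebra := inferInstance
instance : CompleteSpace DiscAlgebra := inferInstance
instance : Nonempty UnitDisc := ⟨⟨0, by simp⟩⟩
instance : NormOneClass DiscAlgebra := ⟨(norm_one : ‖(1 : C(UnitDisc, ℂ))‖ = 1)⟩

/-- Multiplication by the coordinate does not decrease norms, by the maximum principle. -/
theorem norm_le_norm_discCoord_mul {f : C(UnitDisc, ℂ)} (hf : f ∈ DiscAlgebra) :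
    ‖f‖ ≤ ‖discCoord * f‖ := by
  have hcl : IsClosed {f : C(UnitDisc, ℂ) | ‖f‖ ≤ ‖discCoord * f‖} :=
    isClosed_le continuous_norm (by fun_prop)
  refine closure_minimal (fun f hf => ?_) hcl hf
  obtain ⟨p, rfl⟩ := (Algebra.adjoin_singleton_eq_range_aeval ℂ discCoord ▸ hf :
    f ∈ (Polynomial.aeval discCoord).range)
  have hev : ∀ z : UnitDisc, (Polynomial.aeval discCoord p) z = p.eval (z : ℂ) := fun z => by
    have := Polynomial.aeval_algHom_apply (ContinuousMap.evalAlgHom ℂ ℂ z) discCoord p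
    change Polynomial.aeval (z : ℂ) p = _ at this
    rw [Polynomial.coe_aeval_eq_eval] at this
    exact this.symm
  refine (ContinuousMap.norm_le _ (norm_nonneg _)).2 fun z => ?_
  change ‖(Polynomial.aeval discCoord p) z‖ ≤ _
  rw [hev]
  refine Complex.norm_le_of_forall_mem_frontier_norm_le (U := Metric.ball (0 : ℂ) 1)
    Metric.isBounded_ball p.differentiable.diffContOnCl (fun y hy => ?_)
    (by rw [closure_ball _ one_ne_zero]; exact z.2)
  rw [frontier_ball _ one_ne_zero] at hy
  have hy' : ‖y‖ = 1 := by simpa using hy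
  have := (discCoord * Polynomial.aeval discCoord p).norm_coe_le_norm
    ⟨y, Metric.sphere_subset_closedBall hy⟩
  simpa [hev, discCoord, hy'] using this

theorem isDiscAlgebra_discAlgebra :
    IsDiscAlgebra DiscAlgebra ⟨discCoord, Algebra.elemental.self_mem ℂ discCoord⟩ := by
  set w : DiscAlgebra := ⟨discCoord, Algebra.elemental.self_mem ℂ discCoord⟩ with hw
  let ev (z : UnitDisc) : DiscAlgebra →ₐ[ℂ] ℂ :=
    (ContinuousMap.evalAlgHom ℂ ℂ z).comp (Subalgebra.val _)
  have hev : ∀ z f, ev z f = (f : C(UnitDisc, ℂ)) z := fun _ _ => rfl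
  have hw1 : ‖w‖ ≤ 1 := (ContinuousMap.norm_le _ zero_le_one).2 fun z => by
    exact mem_closedBall_zero_iff.1 z.2
  let z0 : UnitDisc := ⟨0, by simp⟩
  have hevw : ev z0 w = 0 := rfl
  let T : ℂ × DiscAlgebra →L[ℂ] DiscAlgebra :=
    (Algebra.linearMap ℂ DiscAlgebra).toContinuousLinearMap.comp (ContinuousLinearMap.fst ..) +
      (ContinuousLinearMap.mul ℂ DiscAlgebra w).comp (ContinuousLinearMap.snd ..)
  have hT : ∀ p, T p = algebraMap ℂ DiscAlgebra p.1 + w * p.2 := fun p => rfl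
  -- the constant term is the value at `0`, so it and the quotient are controlled by the sum
  have hanti : AntilipschitzWith 2 T := by
    refine AddMonoidHomClass.antilipschitz_of_bound T fun p => ?_
    have h1 : ‖p.1‖ ≤ ‖T p‖ := by
      have : ev z0 (T p) = p.1 := by
        rw [hT, map_add, map_mul, hevw, zero_mul, add_zero, AlgHom.commutes, Algebra.algebraMap_self,
          RingHom.id_apply]
      calc ‖p.1‖ = ‖ev z0 (T p)‖ := by rw [this]
        _ ≤ _ := norm_algHom_le _ _
    have h2 : ‖p.2‖ ≤ ‖T p‖ + ‖p.1‖ := by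
      calc ‖p.2‖ ≤ ‖w * p.2‖ := norm_le_norm_discCoord_mul p.2.2
        _ = ‖T p - algebraMap ℂ DiscAlgebra p.1‖ := by rw [hT, add_sub_cancel_left]
        _ ≤ _ := (norm_sub_le _ _).trans_eq (congrArg _ (norm_algebraMap' DiscAlgebra p.1))
    rw [Prod.norm_def]
    refine max_le ?_ ?_ <;> push_cast <;> linarith [norm_nonneg (T p)]
  refine ⟨hw1, ⟨hanti.injective, ?_⟩, fun c hc => ⟨ev ⟨c, by simpa using hc⟩, rfl⟩, fun f hf => ?_⟩
  -- the range is closed and contains all polynomials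
  · have hcl : IsClosed (Set.range T) := hanti.isClosed_range T.uniformContinuous
    have hcl' : IsClosed ((↑) '' Set.range T : Set C(UnitDisc, ℂ)) :=
      (Algebra.elemental.isClosedEmbedding_coe ℂ discCoord).isClosedMap _ hcl
    have hsub : ((Algebra.elemental ℂ discCoord : Subalgebra ℂ C(UnitDisc, ℂ)) : Set _) ⊆
        ((↑) '' Set.range T : Set C(UnitDisc, ℂ)) := by
      refine closure_minimal (fun f hf => ?_) hcl'
      obtain ⟨p, rfl⟩ := (Algebra.adjoin_singleton_eq_range_aeval ℂ discCoord ▸ hf :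
        f ∈ (Polynomial.aeval discCoord).range)
      refine ⟨Polynomial.aeval w p, ⟨(p.coeff 0, Polynomial.aeval w p.divX), ?_⟩, ?_⟩
      · rw [hT]
        have := congrArg (Polynomial.aeval w) (Polynomial.X_mul_divX_add p)
        rw [map_add, map_mul, Polynomial.aeval_X, Polynomial.aeval_C] at this
        exact (add_comm _ _).trans this
      · exact (Polynomial.aeval_algHom_apply (Subalgebra.val DiscAlgebra) w p).symm
    intro f
    obtain ⟨g, ⟨q, hq⟩, hg⟩ := hsub f.2
    exact ⟨q, hq.trans (Subtype.ext hg)⟩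
  · ext z
    exact hf (ev z)

end DiscAlgebra

/-! ### Weierstrass division in the disc algebra -/

section Weierstrass

variable {W : Type*} [NormedCommRing W] [NormedAlgebra ℂ W] {w : W}

/-- The polynomials of degree less than `d` in `w`. -/
def polyMap (w : W) (d : ℕ) : (Fin d → ℂ) →L[ℂ] W :=
  ∑ b : Fin d, (ContinuousLinearMap.proj b).smulRight (w ^ (b : ℕ))

theorem polyMap_apply (d : ℕ) (q : Fin d → ℂ) : polyMap w d q = ∑ b, q b • w ^ (b : ℕ) := by
  simp [polyMap]

/-- The map `(q, h) ↦ q + a h`, with `q` a polynomial of degree less than `d`. -/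
def divMap (w : W) (d : ℕ) (a : W) : (Fin d → ℂ) × W →L[ℂ] W :=
  (polyMap w d).comp (ContinuousLinearMap.fst ℂ _ _) +
    (ContinuousLinearMap.mul ℂ W a).comp (ContinuousLinearMap.snd ℂ _ _)

theorem divMap_apply (d : ℕ) (a : W) (p : (Fin d → ℂ) × W) :
    divMap w d a p = ∑ b, p.1 b • w ^ (b : ℕ) + a * p.2 := by
  simp [divMap, polyMap_apply]

/-- Division by `w ^ d`, the model case. -/
theorem IsDiscAlgebra.bijective_divMap_pow (hw : IsDiscAlgebra W w) (d : ℕ) :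
    Function.Bijective (divMap w d (w ^ d)) := by
  induction d with
  | zero =>
    have h : ∀ p, divMap w 0 (w ^ 0) p = p.2 := fun p => by simp [divMap_apply]
    exact ⟨fun p q hpq => Prod.ext (Subsingleton.elim _ _) (by rwa [h, h] at hpq),
      fun f => ⟨(0, f), h _⟩⟩
  | succ d ih =>
    have h : ∀ p, divMap w (d + 1) (w ^ (d + 1)) p =
        algebraMap ℂ W (p.1 0) + w * divMap w d (w ^ d) (Fin.tail p.1, p.2) := fun p => by
      rw [divMap_apply, divMap_apply, Fin.sum_univ_succ, mul_add, Finset.mul_sum]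
      simp only [Fin.val_zero, pow_zero, Fin.val_succ, pow_succ', mul_smul_comm, Fin.tail,
        Algebra.algebraMap_eq_smul_one, mul_assoc, add_assoc]
    constructor
    · intro p q hpq
      rw [h, h] at hpq
      have h1 := Prod.ext_iff.1 (@hw.bijective.1 (_, _) (_, _) hpq)
      have h2 := Prod.ext_iff.1 (ih.1 h1.2)
      refine Prod.ext ?_ h2.2
      rw [← Fin.cons_self_tail p.1, ← Fin.cons_self_tail q.1]
      exact congrArg₂ _ h1.1 h2.1
    · intro f
      obtain ⟨⟨c, f'⟩, rfl⟩ := hw.bijective.2 f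
      obtain ⟨⟨q, g⟩, rfl⟩ := ih.2 f'
      exact ⟨(Fin.cons c q, g), by rw [h]; simp⟩

theorem IsDiscAlgebra.bijective_divMap_pow_mul (hw : IsDiscAlgebra W w) (d : ℕ) {u : W}
    (hu : IsUnit u) : Function.Bijective (divMap w d (w ^ d * u)) := by
  have h : ∀ p, divMap w d (w ^ d * u) p = divMap w d (w ^ d) (p.1, u * p.2) := fun p => by
    rw [divMap_apply, divMap_apply, mul_assoc]
  obtain ⟨u, rfl⟩ := hu
  constructor
  · intro p q hpq
    rw [h, h] at hpq
    have h1 := Prod.ext_iff.1 ((hw.bijective_divMap_pow d).1 hpq)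
    exact Prod.ext h1.1 (by simpa using h1.2)
  · intro f
    obtain ⟨⟨q, g⟩, rfl⟩ := (hw.bijective_divMap_pow d).2 f
    exact ⟨(q, ↑u⁻¹ * g), by rw [h]; simp⟩

variable [CompleteSpace W]

theorem analyticAt_ringInverse_of_eq_one {E R : Type*} [NormedAddCommGroup E] [NormedSpace ℂ E]
    [NormedRing R] [NormedAlgebra ℂ R] [CompleteSpace R] {A : E → R} {x : E}
    (hA : AnalyticAt ℂ A x) (h : A x = 1) :
    AnalyticAt ℂ (fun y => Ring.inverse (A y)) x ∧ ∀ᶠ y in 𝓝 x, IsUnit (A y) := by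
  refine ⟨AnalyticAt.fun_comp ?_ hA, hA.continuousAt.eventually ?_⟩
  · rw [h]
    exact analyticAt_inverse (𝕜 := ℂ) (1 : Rˣ)
  · rw [h]
    exact (Units.isOpen (R := R)).mem_nhds isUnit_one

theorem analyticAt_clm_apply {E F G : Type*} [NormedAddCommGroup E] [NormedSpace ℂ E]
    [NormedAddCommGroup F] [NormedSpace ℂ F] [NormedAddCommGroup G] [NormedSpace ℂ G]
    {A : E → F →L[ℂ] G} {f : E → F} {x : E} (hA : AnalyticAt ℂ A x) (hf : AnalyticAt ℂ f x) :
    AnalyticAt ℂ (fun y => A y (f y)) x :=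
  ((ContinuousLinearMap.id ℂ (F →L[ℂ] G)).analyticAt_bilinear (A x, f x)).comp₂ hA hf

/-- Weierstrass division: if division with remainder by `a₀` is uniquely possible, so it is by all
nearby elements, and quotient and remainder depend analytically on the divisor. -/
theorem exists_analytic_division {d : ℕ} {a₀ : W} (h : Function.Bijective (divMap w d a₀)) :
    ∃ R : W → (W →L[ℂ] (Fin d → ℂ) × W), AnalyticAt ℂ R a₀ ∧
      ∀ᶠ a in 𝓝 a₀, (∀ f, divMap w d a (R a f) = f) ∧ ∀ p, R a (divMap w d a p) = p := by
  let e : ((Fin d → ℂ) × W) ≃L[ℂ] W := ContinuousLinearEquiv.ofBijective (divMap w d a₀)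
    (LinearMap.ker_eq_bot.2 h.1) (LinearMap.range_eq_top.2 h.2)
  let X := (Fin d → ℂ) × W
  -- composed with the inverse at `a₀`, division by `a₀` becomes the identity
  let A : W → (X →L[ℂ] X) := fun a => (e.symm : W →L[ℂ] X).comp (divMap w d a)
  have hA0 : A a₀ = 1 := by
    exact ContinuousLinearMap.ext fun p => e.symm_apply_apply p
  have hA : ∀ a, AnalyticAt ℂ A a := fun a => by
    have h1 : AnalyticAt ℂ (fun a => divMap w d a) a :=
      analyticAt_const.add <| ((ContinuousLinearMap.compL ℂ X W W).flip
        (ContinuousLinearMap.snd ℂ _ _) |>.analyticAt _).comp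
          ((ContinuousLinearMap.mul ℂ W).analyticAt a)
    exact ((ContinuousLinearMap.compL ℂ X W X (e.symm : W →L[ℂ] X)).analyticAt _).comp h1
  refine ⟨fun a => (Ring.inverse (A a)).comp (e.symm : W →L[ℂ] X), ?_, ?_⟩
  · exact (((ContinuousLinearMap.compL ℂ W X X).flip (e.symm : W →L[ℂ] X)).analyticAt _).fun_comp
      (analyticAt_ringInverse_of_eq_one (A := A) (hA a₀) hA0).1
  · have hu := (analyticAt_ringInverse_of_eq_one (A := A) (hA a₀) hA0).2
    filter_upwards [hu] with a ha
    have h1 : ∀ x, Ring.inverse (A a) (A a x) = x := fun x => by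
      rw [← mul_apply_eq_comp, Ring.inverse_mul_cancel _ ha,
        one_apply_eq_self]
    have h2 : ∀ x, A a (Ring.inverse (A a) x) = x := fun x => by
      rw [← mul_apply_eq_comp, Ring.mul_inverse_cancel _ ha,
        one_apply_eq_self]
    exact ⟨fun f => e.symm.injective (h2 _), fun p => h1 p⟩

/-- Near the origin of the disc, the value of an element at a point depends analytically on the
element and the point. -/
theorem IsDiscAlgebra.exists_analytic_eval (hw : IsDiscAlgebra W w) :
    ∃ K : W → ℂ → ℂ, (∀ f, AnalyticAt ℂ (fun p : W × ℂ => K p.1 p.2) (f, 0)) ∧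
      ∀ᶠ c in 𝓝 (0 : ℂ), ∃ φ : W →ₐ[ℂ] ℂ, φ w = c ∧ ∀ f, φ f = K f c := by
  let T : ℂ × W →L[ℂ] W := (Algebra.linearMap ℂ W).toContinuousLinearMap.comp
    (ContinuousLinearMap.fst ℂ _ _) +
      (ContinuousLinearMap.mul ℂ W w).comp (ContinuousLinearMap.snd ℂ _ _)
  have hT : ⇑T = fun p : ℂ × W => algebraMap ℂ W p.1 + w * p.2 := rfl
  let e : (ℂ × W) ≃L[ℂ] W := ContinuousLinearEquiv.ofBijective T
    (LinearMap.ker_eq_bot.2 (hT ▸ hw.bijective.1)) (LinearMap.range_eq_top.2 (hT ▸ hw.bijective.2))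
  let c₀ : W →L[ℂ] ℂ := (ContinuousLinearMap.fst ℂ ℂ W).comp (e.symm : W →L[ℂ] ℂ × W)
  let S : W →L[ℂ] W := (ContinuousLinearMap.snd ℂ ℂ W).comp (e.symm : W →L[ℂ] ℂ × W)
  have hS : ∀ f, algebraMap ℂ W (c₀ f) + w * S f = f := fun f => e.apply_symm_apply f
  -- `f = f 0 + w * S f` says that the value at `c` of `(1 - c S) f` is `f 0`
  let N : ℂ → (W →L[ℂ] W) := fun c => Ring.inverse (1 - c • S)
  obtain ⟨hN, hu⟩ := analyticAt_ringInverse_of_eq_one (A := fun c : ℂ => 1 - c • S) (x := 0)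
    (by fun_prop) (by rw [zero_smul ℂ S, sub_zero])
  refine ⟨fun f c => c₀ (N c f), fun f => ?_, ?_⟩
  · have h1 : AnalyticAt ℂ (fun p : W × ℂ => N p.2) (f, 0) := hN.fun_comp_of_eq analyticAt_snd rfl
    exact (c₀.analyticAt _).fun_comp (analyticAt_clm_apply h1 analyticAt_fst)
  · filter_upwards [hu, Metric.closedBall_mem_nhds (0 : ℂ) one_pos] with c hc hc1
    obtain ⟨φ, hφ⟩ := hw.exists_char c (mem_closedBall_zero_iff.1 hc1)
    refine ⟨φ, hφ, fun f => ?_⟩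
    have h1 : N c f - c • S (N c f) = f := by
      have := congrArg (· f) (Ring.mul_inverse_cancel _ hc)
      simpa using this
    have h2 := congrArg φ (hS (N c f))
    rw [map_add, map_mul, hφ, AlgHom.commutes] at h2
    have h3 := congrArg φ h1
    rw [map_sub, map_smul, smul_eq_mul] at h3
    rw [← h3, ← h2]
    simp
end Weierstrass

/-! ### Germs of holomorphic functions -/

section Germs

variable {m n : ℕ}

/-- The germ at the origin of a function holomorphic there. -/
def germOf (g : (Fin n → ℂ) → ℂ) (hg : AnalyticAt ℂ g 0) : holoGerms n :=
  ⟨(g : Germ _ _), g, hg, rfl⟩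

theorem exists_germOf_eq (F : holoGerms n) : ∃ g hg, germOf g hg = F := by
  obtain ⟨_, g, hg, rfl⟩ := F
  exact ⟨g, hg, rfl⟩

theorem germOf_sum {ι : Type*} (s : Finset ι) (g : ι → (Fin n → ℂ) → ℂ)
    (hg : ∀ j, AnalyticAt ℂ (g j) 0) :
    germOf (fun z => ∑ j ∈ s, g j z) (Finset.analyticAt_fun_sum s fun j _ => hg j) =
      ∑ j ∈ s, germOf (g j) (hg j) := by
  refine Subtype.ext ?_
  rw [AddSubmonoidClass.coe_finsetSum]
  have := map_sum (Germ.coeRingHom (R := ℂ) (𝓝 (0 : Fin n → ℂ))) g s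
  refine Eq.trans ?_ this
  exact congrArg (Germ.ofFun (l := 𝓝 (0 : Fin n → ℂ))) (by ext z; simp)

theorem germOf_mem_maxId {g : (Fin n → ℂ) → ℂ} {hg : AnalyticAt ℂ g 0} :
    germOf g hg ∈ maxId n ↔ g 0 = 0 := Iff.rfl

theorem isUnit_germOf {g : (Fin n → ℂ) → ℂ} {hg : AnalyticAt ℂ g 0} (h : g 0 ≠ 0) :
    IsUnit (germOf g hg) := by
  refine IsUnit.of_mul_eq_one (germOf _ (hg.inv h)) ?_
  refine Subtype.ext (Germ.coe_eq.2 ?_)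
  filter_upwards [hg.continuousAt.eventually_ne h] with z hz
  exact mul_inv_cancel₀ hz

/-- Pulling back germs of holomorphic functions along a map that fixes the origin. -/
def holoPull (ψ : (Fin m → ℂ) → (Fin n → ℂ)) (hψ : AnalyticAt ℂ ψ 0) (h0 : ψ 0 = 0) :
    holoGerms n →+* holoGerms m where
  toFun F := ⟨(F : Germ (𝓝 (0 : Fin n → ℂ)) ℂ).compTendsto ψ
    (by simpa only [h0] using hψ.continuousAt.tendsto), by
      obtain ⟨_, g, hg, rfl⟩ := F
      exact ⟨g ∘ ψ, hg.comp_of_eq hψ h0, rfl⟩⟩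
  map_one' := rfl
  map_zero' := rfl
  map_mul' F G := by
    obtain ⟨_, g, hg, rfl⟩ := F
    obtain ⟨_, g', hg', rfl⟩ := G
    rfl
  map_add' F G := by
    obtain ⟨_, g, hg, rfl⟩ := F
    obtain ⟨_, g', hg', rfl⟩ := G
    rfl

theorem analyticAt_det {d : ℕ} {M : (Fin n → ℂ) → Matrix (Fin d) (Fin d) ℂ}
    (hM : ∀ k b, AnalyticAt ℂ (fun z => M z k b) 0) : AnalyticAt ℂ (fun z => (M z).det) 0 := by
  simp only [Matrix.det_apply]
  exact Finset.analyticAt_fun_sum _ fun σ _ =>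
    (Finset.analyticAt_fun_prod _ fun i _ => hM _ _).const_smul

theorem germOf_det {d : ℕ} {M : (Fin n → ℂ) → Matrix (Fin d) (Fin d) ℂ}
    (hM : ∀ k b, AnalyticAt ℂ (fun z => M z k b) 0) :
    germOf (fun z => (M z).det) (analyticAt_det hM) =
      (Matrix.of fun k b => germOf (fun z => M z k b) (hM k b)).det := by
  refine Subtype.ext ?_
  let N : Matrix (Fin d) (Fin d) ((Fin n → ℂ) → ℂ) := Matrix.of fun k b z => M z k b
  have h1 : (fun z => (M z).det) = N.det := by
    ext z
    exact ((Pi.evalRingHom (fun _ => ℂ) z).map_det N).symm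
  have h2 := (Germ.coeRingHom (R := ℂ) (𝓝 (0 : Fin n → ℂ))).map_det N
  refine Eq.trans (Eq.trans (congrArg (Germ.ofFun (l := 𝓝 (0 : Fin n → ℂ))) h1) h2) ?_
  exact ((holoGerms n).val.toRingHom.map_det
    (Matrix.of fun k b => germOf (fun z => M z k b) (hM k b))).symm

end Germs

/-! ### Minors and ideals -/

section Algebra

/-- Cramer's rule modulo an ideal. -/
theorem det_mul_mem {A : Type*} [CommRing A] {d : ℕ} (J : Ideal A) (C : Matrix (Fin d) (Fin d) A)
    (v : Fin d → A) (h : ∀ k, ∑ b, C k b * v b ∈ J) (b : Fin d) : C.det * v b ∈ J := by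
  have h1 : C.det • v = C.adjugate.mulVec (C.mulVec v) := by
    rw [Matrix.mulVec_mulVec, Matrix.adjugate_mul, Matrix.smul_mulVec, Matrix.one_mulVec]
  have h2 : C.det * v b = ∑ k, C.adjugate b k * ∑ b', C k b' * v b' := congrFun h1 b
  rw [h2]
  exact J.sum_mem fun k _ => J.mul_mem_left _ (h k)

/-- A matrix with a left inverse has a nonzero maximal minor: expand the determinant of the product
by multilinearity. -/
theorem exists_det_ne_zero {κ : Type*} [Fintype κ] {d : ℕ} (q : Fin d → κ → ℂ)
    (M : κ → Fin d → ℂ) (h : ∀ b b', ∑ k, q b k * M k b' = if b = b' then 1 else 0) :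
    ∃ c : Fin d → κ, (Matrix.of fun k b => M (c k) b).det ≠ 0 := by
  classical
  by_contra! H
  have h1 : Matrix.detRowAlternating (fun b => ∑ k, q b k • M k) = (1 : ℂ) := by
    have : (fun b => ∑ k, q b k • M k) = (1 : Matrix (Fin d) (Fin d) ℂ) := by
      ext b b'
      simp [Finset.sum_apply, h, Matrix.one_apply]
    rw [this]
    exact Matrix.det_one
  rw [← AlternatingMap.coe_multilinearMap, MultilinearMap.map_sum] at h1
  refine one_ne_zero (h1.symm.trans (Finset.sum_eq_zero fun c _ => ?_))
  rw [MultilinearMap.map_smul_univ]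
  exact (congrArg _ (H c)).trans (smul_zero _)

variable {W : Type*} [NormedCommRing W] [NormedAlgebra ℂ W] [CompleteSpace W] {w : W}

/-- If elements `γ j` of the Banach algebra have no common zero on its spectrum, then the matrix
that describes their multiples modulo a divisor `γ j₀` of Weierstrass type has full rank. -/
theorem exists_minor_ne_zero {ι : Type*} [Fintype ι] {d : ℕ} {γ : ι → W} {j₀ : ι}
    {M : ι × Fin d → Fin d → ℂ} {Q : ι × Fin d → W}
    (hbij : Function.Bijective (divMap w d (γ j₀)))
    (hM : ∀ k, γ k.1 * w ^ (k.2 : ℕ) = divMap w d (γ j₀) (M k, Q k))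
    (hγ : ∀ φ : W →ₐ[ℂ] ℂ, ∃ j, φ (γ j) ≠ 0) :
    ∃ c : Fin d → ι × Fin d, (Matrix.of fun k b => M (c k) b).det ≠ 0 := by
  classical
  have htop : Ideal.span (Set.range γ) = ⊤ := by
    by_contra hne
    obtain ⟨P, hP, hle⟩ := Ideal.exists_le_maximal _ hne
    obtain ⟨j, hj⟩ := hγ (WeakDual.CharacterSpace.toAlgHom P.toCharacterSpace)
    exact hj (P.toCharacterSpace_apply_eq_zero_of_mem (hle (Ideal.subset_span ⟨j, rfl⟩)))
  have h1 : ∀ b : Fin d, ∃ f : ι → W, ∑ j, f j * γ j = w ^ (b : ℕ) := fun b =>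
    Ideal.mem_span_range_iff_exists_fun.1 (htop ▸ Submodule.mem_top)
  choose f hf using h1
  -- dividing the coefficients of the Bézout relations by `γ j₀` gives a left inverse of `M`
  choose p hp using fun (b : Fin d) (j : ι) => hbij.2 (f b j)
  refine exists_det_ne_zero (fun b k => (p b k.1).1 k.2) M fun b b' => ?_
  have h2 : divMap w d (γ j₀) (fun b' => ∑ k : ι × Fin d, (p b k.1).1 k.2 * M k b',
      ∑ k : ι × Fin d, (p b k.1).1 k.2 • Q k + ∑ j, (p b j).2 * γ j) =
      divMap w d (γ j₀) (Pi.single b 1, 0) := by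
    have h3 : divMap w d (γ j₀) (Pi.single b 1, 0) = w ^ (b : ℕ) := by
      simp [divMap_apply, Pi.single_apply]
    have h4 : (fun b' => ∑ k : ι × Fin d, (p b k.1).1 k.2 * M k b',
        ∑ k : ι × Fin d, (p b k.1).1 k.2 • Q k + ∑ j, (p b j).2 * γ j) =
        ∑ k : ι × Fin d, (p b k.1).1 k.2 • (M k, Q k) +
          ((0 : Fin d → ℂ), ∑ j, (p b j).2 * γ j) := by
      refine Prod.ext ?_ ?_
      · ext b'; simp [Prod.fst_sum, Finset.sum_apply]
      · simp [Prod.snd_sum]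
    rw [h3, h4, map_add, map_sum, ← hf b]
    simp only [map_smul, ← hM]
    have h5 : divMap w d (γ j₀) ((0 : Fin d → ℂ), ∑ j, (p b j).2 * γ j) =
        ∑ j, γ j₀ * (p b j).2 * γ j := by
      simp [divMap_apply, Finset.mul_sum, mul_assoc]
    rw [h5, Fintype.sum_prod_type, ← Finset.sum_add_distrib]
    refine Finset.sum_congr rfl fun j _ => ?_
    rw [← hp b j, divMap_apply, add_mul, Finset.sum_mul]
    congr 1
    exact Finset.sum_congr rfl fun i _ => by rw [smul_mul_assoc, mul_comm (γ j)]
  have h3 := congrFun (Prod.ext_iff.1 (hbij.1 h2)).1 b'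
  simpa [Pi.single_apply, eq_comm] using h3

end Algebra

/-! ### Weierstrass division of germs -/

section Division

variable {n : ℕ} {W : Type*} [NormedCommRing W] [NormedAlgebra ℂ W] {w : W}

/-- The map `γ` into the Banach algebra `W` encodes the function `p` of `n + 1` variables near the
origin: the element `γ z` represents the function `c ↦ p (r c, z)` on the unit disc. -/
structure IsLift (w : W) (r : ℝ) (p : (Fin (n + 1) → ℂ) → ℂ) (γ : (Fin n → ℂ) → W) : Prop where
  analyticAt : AnalyticAt ℂ γ 0
  eval : ∀ᶠ z in 𝓝 (0 : Fin n → ℂ), ∀ φ : W →ₐ[ℂ] ℂ, φ (γ z) = p (Fin.cons (r * φ w) z)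

theorem IsLift.mul {r : ℝ} {p p' : (Fin (n + 1) → ℂ) → ℂ} {γ γ' : (Fin n → ℂ) → W}
    (h : IsLift w r p γ) (h' : IsLift w r p' γ') :
    IsLift w r (fun x => p x * p' x) fun z => γ z * γ' z where
  analyticAt := h.analyticAt.mul h'.analyticAt
  eval := by
    filter_upwards [h.eval, h'.eval] with z hz hz' φ
    rw [map_mul, hz, hz']

theorem isLift_coord_pow {r : ℝ} (hr : 0 < r) (i : ℕ) :
    IsLift w r (fun x : Fin (n + 1) → ℂ => (x 0 / r) ^ i) fun _ => w ^ i where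
  analyticAt := analyticAt_const
  eval := Eventually.of_forall fun z φ => by
    have : (r : ℂ) ≠ 0 := by exact_mod_cast hr.ne'
    rw [map_pow, Fin.cons_zero, mul_div_cancel_left₀ _ this]

variable [CompleteSpace W]

/-- Every holomorphic function lifts on small discs: evaluate it at the point `(r w, z)` of
`Wⁿ⁺¹`. -/
theorem eventually_exists_isLift [NormOneClass W] {p : (Fin (n + 1) → ℂ) → ℂ}
    (hp : AnalyticAt ℂ p 0) (w : W) :
    ∀ᶠ r in 𝓝[>] (0 : ℝ), ∃ γ : (Fin n → ℂ) → W, IsLift w r p γ := by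
  obtain ⟨G, hG, hGp⟩ := exists_algebra_extension (W := W) hp
  let x : ℝ → (Fin n → ℂ) → Fin (n + 1) → W := fun r z =>
    Fin.cons ((r : ℂ) • w) fun i => algebraMap ℂ W (z i)
  have hx : ∀ r z, AnalyticAt ℂ (x r) z := fun r z => by
    rw [analyticAt_pi_iff]
    intro i
    refine Fin.cases ?_ (fun i => ?_) i
    · exact analyticAt_const
    · exact ((Algebra.linearMap ℂ W).toContinuousLinearMap.comp
        (ContinuousLinearMap.proj (R := ℂ) (φ := fun _ : Fin n => ℂ) i)).analyticAt z
  have hx0 : Tendsto (fun r => x r 0) (𝓝[>] 0) (𝓝 0) := by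
    refine tendsto_nhdsWithin_of_tendsto_nhds ?_
    rw [tendsto_pi_nhds]
    intro i
    refine Fin.cases ?_ (fun i => ?_) i
    · have : Continuous fun r : ℝ => (r : ℂ) • w := by fun_prop
      simpa [x] using this.tendsto 0
    · simp [x]
  filter_upwards [hx0.eventually hG.eventually_analyticAt,
    hx0.eventually hGp.eventually_nhds] with r h1 h2
  refine ⟨fun z => G (x r z), h1.fun_comp (hx r 0), ?_⟩
  filter_upwards [(hx r 0).continuousAt.eventually h2] with z hz φ
  rw [hz φ]
  congr 1
  ext i
  refine Fin.cases ?_ (fun i => ?_) i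
  · exact map_smul φ (r : ℂ) w
  · simp [x]

/-- Weierstrass division of germs: a germ of `n + 1` variables is, modulo `g`, a polynomial in the
first variable with coefficients in the germs of `n` variables. The coefficients are those of a
division in the Banach algebra. -/
theorem IsLift.exists_division (hw : IsDiscAlgebra W w) {r : ℝ} (hr : 0 < r) {d : ℕ}
    {g : (Fin (n + 1) → ℂ) → ℂ} {γ₀ : (Fin n → ℂ) → W} (hγ₀ : IsLift w r g γ₀)
    (hbij : Function.Bijective (divMap w d (γ₀ 0)))
    {p : (Fin (n + 1) → ℂ) → ℂ} {γ : (Fin n → ℂ) → W} (hγ : IsLift w r p γ) :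
    ∃ a : Fin d → (Fin n → ℂ) → ℂ, ∃ Q : (Fin n → ℂ) → W, ∃ h : (Fin (n + 1) → ℂ) → ℂ,
      (∀ b, AnalyticAt ℂ (a b) 0) ∧ AnalyticAt ℂ h 0 ∧
      (∀ᶠ z in 𝓝 0, Function.Bijective (divMap w d (γ₀ z)) ∧
        γ z = divMap w d (γ₀ z) (fun b => a b z, Q z)) ∧
      ∀ᶠ x in 𝓝 (0 : Fin (n + 1) → ℂ),
        p x = ∑ b, a b (Fin.tail x) * (x 0 / r) ^ (b : ℕ) + g x * h x := by
  obtain ⟨R, hR, hRe⟩ := exists_analytic_division hbij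
  obtain ⟨K, hK, hKe⟩ := hw.exists_analytic_eval
  have hr0 : (r : ℂ) ≠ 0 := by exact_mod_cast hr.ne'
  have hq : AnalyticAt ℂ (fun z => R (γ₀ z) (γ z)) 0 :=
    analyticAt_clm_apply (hR.fun_comp hγ₀.analyticAt) hγ.analyticAt
  have hQ : AnalyticAt ℂ (fun z => (R (γ₀ z) (γ z)).2) 0 :=
    ((ContinuousLinearMap.snd ℂ (Fin d → ℂ) W).analyticAt _).fun_comp hq
  have htail : AnalyticAt ℂ (fun x : Fin (n + 1) → ℂ => (Fin.tail x : Fin n → ℂ)) 0 := by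
    rw [analyticAt_pi_iff]
    exact fun i => (ContinuousLinearMap.proj (R := ℂ) (φ := fun _ : Fin (n + 1) => ℂ)
      i.succ).analyticAt _
  have hcoord : AnalyticAt ℂ (fun x : Fin (n + 1) → ℂ => x 0 / r) 0 :=
    ((ContinuousLinearMap.proj (R := ℂ) (φ := fun _ : Fin (n + 1) => ℂ) 0).analyticAt _).div_const
  have htail0 : Fin.tail (0 : Fin (n + 1) → ℂ) = (0 : Fin n → ℂ) := rfl
  have hdiv : ∀ᶠ z in 𝓝 (0 : Fin n → ℂ), Function.Bijective (divMap w d (γ₀ z)) ∧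
      γ z = divMap w d (γ₀ z) (fun b => (R (γ₀ z) (γ z)).1 b, (R (γ₀ z) (γ z)).2) := by
    filter_upwards [hγ₀.analyticAt.continuousAt.eventually hRe] with z hz
    exact ⟨⟨Function.LeftInverse.injective hz.2, Function.RightInverse.surjective hz.1⟩,
      (hz.1 (γ z)).symm⟩
  refine ⟨fun b z => (R (γ₀ z) (γ z)).1 b, fun z => (R (γ₀ z) (γ z)).2,
    fun x => K (R (γ₀ (Fin.tail x)) (γ (Fin.tail x))).2 (x 0 / r), fun b => ?_, ?_, hdiv, ?_⟩
  · exact (((ContinuousLinearMap.proj (R := ℂ) (φ := fun _ : Fin d => ℂ) b).comp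
      (ContinuousLinearMap.fst ℂ (Fin d → ℂ) W)).analyticAt _).fun_comp hq
  · have h1 : AnalyticAt ℂ
        (fun x : Fin (n + 1) → ℂ => (R (γ₀ (Fin.tail x)) (γ (Fin.tail x))).2) 0 :=
      hQ.fun_comp_of_eq htail htail0
    exact (hK (R (γ₀ 0) (γ 0)).2).fun_comp_of_eq (h1.prod hcoord) (by simp [htail0])
  · have ht : Tendsto (fun x : Fin (n + 1) → ℂ => (Fin.tail x : Fin n → ℂ)) (𝓝 0) (𝓝 0) :=
      htail.continuousAt.tendsto
    have hc : Tendsto (fun x : Fin (n + 1) → ℂ => x 0 / (r : ℂ)) (𝓝 0) (𝓝 0) := by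
      simpa using hcoord.continuousAt.tendsto
    filter_upwards [ht.eventually hdiv, ht.eventually hγ₀.eval, ht.eventually hγ.eval,
      hc.eventually hKe] with x h1 h2 h3 ⟨φ, h4, h5⟩
    have hx : (Fin.cons (r * φ w) (Fin.tail x) : Fin (n + 1) → ℂ) = x := by
      rw [h4, mul_div_cancel₀ _ hr0, Fin.cons_self_tail]
    have h6 := congrArg φ h1.2
    rw [h3, hx, divMap_apply, map_add, map_mul, h2, hx, map_sum, h5] at h6
    simp only [map_smul, map_pow, h4, smul_eq_mul] at h6
    exact h6

end Division

/-! ### The Nullstellensatz for an isolated zero -/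

section Nullstellensatz

/-- The Nullstellensatz in `n` variables for isolated zeros: if the origin is an isolated common
zero (or no common zero) of finitely many holomorphic functions, then the ideal of their germs
contains a power of each germ that vanishes at the origin. -/
def IsolatedNullstellensatz (n : ℕ) : Prop :=
  ∀ (ι : Type) [Fintype ι] (g : ι → (Fin n → ℂ) → ℂ) (hg : ∀ j, AnalyticAt ℂ (g j) 0),
    (∀ᶠ z in 𝓝[≠] 0, ∃ j, g j z ≠ 0) →
      maxId n ≤ (Ideal.span (Set.range fun j => germOf (g j) (hg j))).radical

variable {n : ℕ}

theorem eventually_nhdsGT_zero_lt {ε : ℝ} (hε : 0 < ε) : ∀ᶠ r in 𝓝[>] (0 : ℝ), r < ε :=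
  mem_nhdsWithin_of_mem_nhds (Iio_mem_nhds hε)

theorem analyticAt_tail (x : Fin (n + 1) → ℂ) :
    AnalyticAt ℂ (Fin.tail : (Fin (n + 1) → ℂ) → Fin n → ℂ) x := by
  rw [analyticAt_pi_iff]
  exact fun i => (ContinuousLinearMap.proj (R := ℂ) (φ := fun _ : Fin (n + 1) => ℂ)
    i.succ).analyticAt _

theorem norm_cons_le (c : ℂ) (z : Fin n → ℂ) :
    ‖(Fin.cons c z : Fin (n + 1) → ℂ)‖ ≤ max ‖c‖ ‖z‖ := by
  refine (pi_norm_le_iff_of_nonneg (by positivity)).2 fun i => ?_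
  refine Fin.cases ?_ (fun i => ?_) i
  · exact le_max_left _ _
  · exact (norm_le_pi_norm z i).trans (le_max_right _ _)

variable {W : Type*} [NormedCommRing W] [NormedAlgebra ℂ W] [CompleteSpace W] [NormOneClass W]
  {w : W}

/-- A lift of a function that vanishes to order `d` along the first coordinate axis is a unit
multiple of `w ^ d` at the origin. -/
theorem eventually_lift_eq_pow_mul_unit (hw : IsDiscAlgebra W w) {g : (Fin (n + 1) → ℂ) → ℂ} {d : ℕ}
    {u : ℂ → ℂ} (hu : AnalyticAt ℂ u 0) (hu0 : u 0 ≠ 0)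
    (hgu : ∀ᶠ c in 𝓝 (0 : ℂ), g (Fin.cons c 0) = c ^ d * u c) :
    ∀ᶠ r in 𝓝[>] (0 : ℝ), ∀ γ : (Fin n → ℂ) → W, IsLift w r g γ →
      ∃ U, IsUnit U ∧ γ 0 = w ^ d * U := by
  have hu' : AnalyticAt ℂ (fun x : Fin (n + 1) → ℂ => u (x 0)) 0 :=
    hu.fun_comp_of_eq ((ContinuousLinearMap.proj (R := ℂ) (φ := fun _ : Fin (n + 1) => ℂ)
      0).analyticAt _) rfl
  obtain ⟨ε, hε, h⟩ := Metric.eventually_nhds_iff_ball.1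
    (hgu.and (hu.continuousAt.eventually_ne hu0))
  filter_upwards [eventually_exists_isLift hu' w, eventually_nhdsGT_zero_lt hε, self_mem_nhdsWithin]
    with r ⟨υ, hυ⟩ hrε hr γ hγ
  have hr0 : (r : ℂ) ≠ 0 := by exact_mod_cast (ne_of_gt hr)
  have hmem : ∀ φ : W →ₐ[ℂ] ℂ, (r * φ w : ℂ) ∈ Metric.ball (0 : ℂ) ε := fun φ => by
    rw [mem_ball_zero_iff, norm_mul, Complex.norm_real, Real.norm_of_nonneg (le_of_lt hr)]
    have : ‖φ w‖ ≤ 1 := (norm_algHom_le φ w).trans hw.norm_le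
    nlinarith [show (0 : ℝ) < r from hr]
  refine ⟨(r : ℂ) ^ d • υ 0, ?_, ?_⟩
  · refine IsUnit.smul (Units.mk0 ((r : ℂ) ^ d) (pow_ne_zero _ hr0)) (m := υ 0) ?_
    by_contra hnot
    obtain ⟨φ, hφ⟩ := WeakDual.CharacterSpace.exists_apply_eq_zero hnot
    have h1 := hυ.eval.self_of_nhds (WeakDual.CharacterSpace.toAlgHom φ)
    rw [Fin.cons_zero] at h1
    exact (h _ (hmem _)).2 (h1.symm.trans hφ)
  · rw [← sub_eq_zero]
    refine hw.eq_zero _ fun φ => ?_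
    rw [map_sub, hγ.eval.self_of_nhds φ, (h _ (hmem φ)).1, map_mul, map_smul, map_pow,
      hυ.eval.self_of_nhds φ, Fin.cons_zero, smul_eq_mul]
    ring

/-- The inductive step, when one of the functions does not vanish identically on the first axis. The
maximal minors of the matrix of multiplication by the `g j` modulo `g j₀` lie in the ideal, depend
only on the last `n` variables and again have an isolated common zero. -/
theorem IsolatedNullstellensatz.succ_of_regular (hw : IsDiscAlgebra W w)
    (ih : IsolatedNullstellensatz n)
    {ι : Type} [Fintype ι] (g : ι → (Fin (n + 1) → ℂ) → ℂ) (hg : ∀ j, AnalyticAt ℂ (g j) 0)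
    (hiso : ∀ᶠ z in 𝓝[≠] 0, ∃ j, g j z ≠ 0) (j₀ : ι)
    (hreg : ¬ ∀ᶠ c in 𝓝 (0 : ℂ), g j₀ (Fin.cons c 0) = 0) :
    maxId (n + 1) ≤ (Ideal.span (Set.range fun j => germOf (g j) (hg j))).radical := by
  set J := Ideal.span (Set.range fun j => germOf (g j) (hg j))
  have hgJ : ∀ j, germOf (g j) (hg j) ∈ J := fun j => Ideal.subset_span ⟨j, rfl⟩
  -- the order `d` of vanishing along the first axis
  have hline : AnalyticAt ℂ (fun c : ℂ => (Fin.cons c 0 : Fin (n + 1) → ℂ)) 0 := by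
    rw [analyticAt_pi_iff]
    intro i
    refine Fin.cases ?_ (fun i => ?_) i
    · exact analyticAt_id
    · exact analyticAt_const
  have hline0 : (Fin.cons 0 0 : Fin (n + 1) → ℂ) = 0 := Fin.cons_self_tail (0 : Fin (n + 1) → ℂ)
  obtain ⟨d, u, hu, hu0, hgu⟩ :=
    ((hg j₀).fun_comp_of_eq hline hline0).exists_eventuallyEq_pow_smul_nonzero_iff.2 hreg
  simp only [sub_zero, smul_eq_mul] at hgu
  rcases Nat.eq_zero_or_pos d with rfl | hd
  · have h0 : g j₀ 0 ≠ 0 := by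
      have := hgu.self_of_nhds
      rw [hline0] at this
      simpa [this] using hu0
    rw [J.eq_top_of_isUnit_mem (hgJ j₀) (isUnit_germOf h0), Ideal.radical_top]
    exact le_top
  intro H hH
  obtain ⟨h, hh, rfl⟩ := exists_germOf_eq H
  rw [germOf_mem_maxId] at hH
  -- choose the radius of the disc
  obtain ⟨ε, hε, hball⟩ := Metric.eventually_nhds_iff_ball.1 (eventually_nhdsWithin_iff.1 hiso)
  obtain ⟨r, hγ, ⟨η, hη⟩, hunit, hrε, hr⟩ :=
    ((eventually_all.2 fun j => eventually_exists_isLift (hg j) w).and <|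
      (eventually_exists_isLift hh w).and <| (eventually_lift_eq_pow_mul_unit hw hu hu0 hgu).and <|
      (eventually_nhdsGT_zero_lt hε).and self_mem_nhdsWithin).exists
  replace hr : 0 < r := hr
  choose γ hγ using hγ
  obtain ⟨U, hU, hγU⟩ := hunit _ (hγ j₀)
  have hbij : Function.Bijective (divMap w d (γ j₀ 0)) :=
    hγU ▸ hw.bijective_divMap_pow_mul d hU
  have hcoord : AnalyticAt ℂ (fun x : Fin (n + 1) → ℂ => x 0 / r) 0 :=
    ((ContinuousLinearMap.proj (R := ℂ) (φ := fun _ : Fin (n + 1) => ℂ) 0).analyticAt _).div_const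
  set ξ : holoGerms (n + 1) := germOf _ hcoord
  let π : holoGerms n →+* holoGerms (n + 1) := holoPull Fin.tail (analyticAt_tail 0) rfl
  -- division by `g j₀` in terms of germs
  have hgerm : ∀ {p q : (Fin (n + 1) → ℂ) → ℂ} (hp : AnalyticAt ℂ p 0) (hq : AnalyticAt ℂ q 0)
      {a : Fin d → (Fin n → ℂ) → ℂ} (ha : ∀ b, AnalyticAt ℂ (a b) 0),
      (∀ᶠ x in 𝓝 (0 : Fin (n + 1) → ℂ),
        p x = ∑ b, a b (Fin.tail x) * (x 0 / r) ^ (b : ℕ) + g j₀ x * q x) →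
      germOf p hp - ∑ b, π (germOf (a b) (ha b)) * ξ ^ (b : ℕ) ∈ J := by
    intro p q hp hq a ha hpq
    have ha' : ∀ b : Fin d, AnalyticAt ℂ
        (fun x : Fin (n + 1) → ℂ => a b (Fin.tail x) * (x 0 / r) ^ (b : ℕ)) 0 := fun b =>
      ((ha b).fun_comp_of_eq (analyticAt_tail 0) rfl).mul (hcoord.pow _)
    have h1 : germOf p hp = ∑ b, π (germOf (a b) (ha b)) * ξ ^ (b : ℕ) +
        germOf (g j₀) (hg j₀) * germOf q hq := by
      have h2 := germOf_sum Finset.univ _ ha'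
      refine Eq.trans ?_ (congrArg (· + germOf (g j₀) (hg j₀) * germOf q hq) h2)
      exact Subtype.ext (Germ.coe_eq.2 hpq)
    rw [h1, add_sub_cancel_left]
    exact J.mul_mem_right _ (hgJ j₀)
  -- the matrix of the multiples of the `g j` modulo `g j₀`
  have hk := fun k : ι × Fin d =>
    (hγ j₀).exists_division hw hr hbij ((hγ k.1).mul (isLift_coord_pow hr (k.2 : ℕ)))
  choose M Q q hM hq hMQ hMq using hk
  have hmul : ∀ k : ι × Fin d, ∑ b, π (germOf (M k b) (hM k b)) * ξ ^ (b : ℕ) ∈ J := by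
    intro k
    have h1 := hgerm ((hg k.1).mul (hcoord.pow _)) (hq k) (hM k) (hMq k)
    have h2 : germOf _ ((hg k.1).mul (hcoord.pow (k.2 : ℕ))) ∈ J :=
      J.mul_mem_right (ξ ^ (k.2 : ℕ)) (hgJ k.1)
    exact (Submodule.sub_mem_iff_right J h2).1 h1
  have hminor : ∀ (c : Fin d → ι × Fin d) k b,
      AnalyticAt ℂ (fun z => (Matrix.of fun k b => M (c k) b z) k b) 0 := fun c k b => hM (c k) b
  have hdet : ∀ c : Fin d → ι × Fin d, π (germOf _ (analyticAt_det (hminor c))) ∈ J := by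
    intro c
    rw [germOf_det (hminor c), RingHom.map_det]
    have := det_mul_mem J (π.mapMatrix (Matrix.of fun k b => germOf _ (hminor c k b)))
      (fun b => ξ ^ (b : ℕ)) (fun k => hmul (c k)) ⟨0, hd⟩
    simpa using this
  -- the minors have an isolated common zero
  have hiso' : ∀ᶠ z in 𝓝[≠] (0 : Fin n → ℂ), ∃ c : Fin d → ι × Fin d,
      (Matrix.of fun k b => M (c k) b z).det ≠ 0 := by
    refine eventually_nhdsWithin_iff.2 ?_
    filter_upwards [Metric.ball_mem_nhds 0 hε, eventually_all.2 hMQ,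
      eventually_all.2 fun j => (hγ j).eval] with z hzε hz1 hz2 hz0
    have h1 : ∀ φ : W →ₐ[ℂ] ℂ, ∃ j, φ (γ j z) ≠ 0 := fun φ => by
      have h2 : (Fin.cons (r * φ w) z : Fin (n + 1) → ℂ) ∈ Metric.ball 0 ε := by
        rw [mem_ball_zero_iff] at hzε ⊢
        refine (norm_cons_le _ _).trans_lt (max_lt ?_ hzε)
        rw [norm_mul, Complex.norm_real, Real.norm_of_nonneg hr.le]
        have : ‖φ w‖ ≤ 1 := (norm_algHom_le φ w).trans hw.norm_le
        nlinarith
      have h3 : (Fin.cons (r * φ w) z : Fin (n + 1) → ℂ) ≠ 0 := fun h0 =>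
        hz0 (congrArg Fin.tail h0)
      obtain ⟨j, hj⟩ := hball _ h2 h3
      exact ⟨j, by rwa [hz2 j φ]⟩
    exact exists_minor_ne_zero (γ := fun j => γ j z) (M := fun k b => M k b z)
      (Q := fun k => Q k z) (hz1 (j₀, ⟨0, hd⟩)).1 (fun k => (hz1 k).2) h1
  -- germs of `n` variables that vanish at the origin are nilpotent modulo `J`
  have hπ : ∀ F ∈ maxId n, π F ∈ J.radical := by
    intro F hF
    obtain ⟨N, hN⟩ := ih _ _ (fun c => analyticAt_det (hminor c)) hiso' hF
    have hle : Ideal.span (Set.range fun c => germOf _ (analyticAt_det (hminor c))) ≤ J.comap π :=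
      Ideal.span_le.2 (by rintro _ ⟨c, rfl⟩; exact hdet c)
    exact ⟨N, by rw [← map_pow]; exact hle hN⟩
  -- the first coordinate is nilpotent modulo `J`
  have hξJ : ξ ∈ J.radical := by
    obtain ⟨a, Q', q', ha, hq', hQ', hp⟩ :=
      (hγ j₀).exists_division hw hr hbij (isLift_coord_pow hr d)
    have ha0 : ∀ b, a b 0 = 0 := by
      obtain ⟨U, rfl⟩ := hU
      -- at the origin `w ^ d` is a multiple of the divisor
      have h1 : divMap w d (γ j₀ 0) (fun b => a b 0, Q' 0) =
          divMap w d (γ j₀ 0) (0, ((U⁻¹ : Wˣ) : W)) := by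
        rw [← hQ'.self_of_nhds.2, divMap_apply, hγU]
        simp [mul_assoc]
      exact fun b => congrFun (Prod.ext_iff.1 (hbij.1 h1)).1 b
    have h1 : ξ ^ d - ∑ b, π (germOf (a b) (ha b)) * ξ ^ (b : ℕ) ∈ J.radical :=
      Ideal.le_radical (hgerm (hcoord.pow d) hq' ha hp)
    have h2 : ∑ b, π (germOf (a b) (ha b)) * ξ ^ (b : ℕ) ∈ J.radical :=
      Ideal.sum_mem _ fun b _ => Ideal.mul_mem_right _ _ (hπ _ (germOf_mem_maxId.2 (ha0 b)))
    exact (Ideal.radical_isRadical J) ⟨d, (Submodule.sub_mem_iff_left _ h2).1 h1⟩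
  -- conclusion by dividing `h`
  obtain ⟨a, Q', q', ha, hq', hQ', hp⟩ := (hγ j₀).exists_division hw hr hbij hη
  have ha0 : a ⟨0, hd⟩ 0 = 0 := by
    have h1 := hp.self_of_nhds
    rw [hH, show g j₀ 0 = 0 from ?_, zero_mul, add_zero, Finset.sum_eq_single ⟨0, hd⟩] at h1
    · simpa [show Fin.tail (0 : Fin (n + 1) → ℂ) = 0 from rfl] using h1.symm
    · intro b _ hb
      have : (b : ℕ) ≠ 0 := fun h0 => hb (Fin.ext h0)
      simp [this]
    · simp
    · have := hgu.self_of_nhds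
      rw [hline0] at this
      simpa [hd.ne'] using this
  refine (Submodule.sub_mem_iff_left _ ?_).1 (Ideal.le_radical (hgerm hh hq' ha hp))
  refine Ideal.sum_mem _ fun b _ => ?_
  by_cases hb : (b : ℕ) = 0
  · obtain rfl : b = ⟨0, hd⟩ := Fin.ext hb
    exact Ideal.mul_mem_right _ _ (hπ _ (germOf_mem_maxId.2 ha0))
  · exact Ideal.mul_mem_left _ _ (Ideal.pow_mem_of_mem _ hξJ _ (Nat.pos_of_ne_zero hb))

theorem exists_line_not_eventually_zero {g : (Fin (n + 1) → ℂ) → ℂ} (hg : AnalyticAt ℂ g 0)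
    (h : ¬ ∀ᶠ z in 𝓝 0, g z = 0) :
    ∃ v : Fin (n + 1) → ℂ, v ≠ 0 ∧ ¬ ∀ᶠ c in 𝓝 (0 : ℂ), g (c • v) = 0 := by
  by_cases h0 : g 0 = 0
  · obtain ⟨ε, hε, hball⟩ := Metric.eventually_nhds_iff_ball.1 hg.eventually_analyticAt
    obtain ⟨v, hv, hvε⟩ := ((not_eventually.1 h).and_eventually (Metric.ball_mem_nhds 0 hε)).exists
    refine ⟨v, fun hv0 => hv (hv0 ▸ h0), fun H => hv ?_⟩
    -- the identity theorem along the line through `v`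
    let L : ℂ →L[ℂ] (Fin (n + 1) → ℂ) := (ContinuousLinearMap.id ℂ ℂ).smulRight v
    have hconn : IsPreconnected (L ⁻¹' Metric.ball 0 ε) :=
      (((convex_ball (0 : Fin (n + 1) → ℂ) ε).is_linear_preimage
        (L.restrictScalars ℝ).toLinearMap.isLinear)).isPreconnected
    have han : AnalyticOnNhd ℂ (fun c => g (L c)) (L ⁻¹' Metric.ball 0 ε) := fun c hc =>
      (hball _ hc).fun_comp (L.analyticAt c)
    have h1 := han.eqOn_zero_of_preconnected_of_eventuallyEq_zero hconn
      (z₀ := 0) (by simpa using hε) H (show (1 : ℂ) ∈ _ by simpa [L] using hvε)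
    simpa [L] using h1
  · refine ⟨Pi.single 0 1, fun h1 => one_ne_zero (α := ℂ) (by simpa using congrFun h1 0),
      fun H => h0 ?_⟩
    simpa using H.self_of_nhds

/-- The conclusion of the Nullstellensatz is invariant under linear changes of coordinates. -/
theorem maxId_le_radical_of_linear {ι : Type} {g : ι → (Fin n → ℂ) → ℂ}
    {hg : ∀ j, AnalyticAt ℂ (g j) 0} (A : (Fin n → ℂ) ≃L[ℂ] (Fin n → ℂ))
    {hgA : ∀ j, AnalyticAt ℂ (g j ∘ A) 0}
    (h : maxId n ≤ (Ideal.span (Set.range fun j => germOf (g j ∘ A) (hgA j))).radical) :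
    maxId n ≤ (Ideal.span (Set.range fun j => germOf (g j) (hg j))).radical := by
  intro F hF
  obtain ⟨f, hf, rfl⟩ := exists_germOf_eq F
  have hfA : AnalyticAt ℂ (f ∘ A) 0 :=
    hf.comp_of_eq (A.analyticAt 0) (map_zero A)
  have h1 : germOf (f ∘ A) hfA ∈ maxId n := by
    rw [germOf_mem_maxId] at hF ⊢
    simpa using hF
  obtain ⟨N, hN⟩ := h h1
  let π := holoPull A.symm (A.symm.analyticAt 0) (map_zero A.symm)
  have hπ : ∀ (p : (Fin n → ℂ) → ℂ) (hp : AnalyticAt ℂ p 0) (hpA : AnalyticAt ℂ (p ∘ A) 0),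
      π (germOf (p ∘ A) hpA) = germOf p hp := fun p hp hpA =>
    Subtype.ext (Germ.coe_eq.2 (Eventually.of_forall fun z => by simp))
  have hle : Ideal.span (Set.range fun j => germOf (g j ∘ A) (hgA j)) ≤
      (Ideal.span (Set.range fun j => germOf (g j) (hg j))).comap π :=
    Ideal.span_le.2 (by
      rintro _ ⟨j, rfl⟩
      exact Ideal.mem_comap.2 (by rw [hπ _ (hg j)]; exact Ideal.subset_span ⟨j, rfl⟩))
  refine ⟨N, ?_⟩
  rw [← hπ f hf hfA, ← map_pow]
  exact hle hN

theorem isolatedNullstellensatz (n : ℕ) : IsolatedNullstellensatz n := by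
  induction n with
  | zero =>
    intro ι _ g hg _ F hF
    obtain ⟨f, hf, rfl⟩ := exists_germOf_eq F
    rw [germOf_mem_maxId] at hF
    have : germOf f hf = 0 := Subtype.ext (Germ.coe_eq.2 (Eventually.of_forall fun z => by
      rw [Subsingleton.elim z 0, hF]))
    rw [this]
    exact zero_mem _
  | succ n ih =>
    intro ι _ g hg hiso
    obtain ⟨j₀, hj₀⟩ : ∃ j, ¬ ∀ᶠ z in 𝓝 0, g j z = 0 := by
      by_contra! H
      obtain ⟨z, ⟨j, hj⟩, hz⟩ :=
        (hiso.and (eventually_nhdsWithin_of_eventually_nhds (eventually_all.2 H))).exists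
      exact hj (hz j)
    obtain ⟨v, hv, hline⟩ := exists_line_not_eventually_zero (hg j₀) hj₀
    obtain ⟨A, hA⟩ := SeparatingDual.exists_continuousLinearEquiv_apply_eq (R := ℂ)
      (x := (Pi.single 0 1 : Fin (n + 1) → ℂ)) (y := v)
      (fun h1 => one_ne_zero (α := ℂ) (by simpa using congrFun h1 0)) hv
    have hgA : ∀ j, AnalyticAt ℂ (g j ∘ A) 0 := fun j =>
      (hg j).comp_of_eq (A.analyticAt 0) (map_zero A)
    refine maxId_le_radical_of_linear A (hgA := hgA)
      (ih.succ_of_regular isDiscAlgebra_discAlgebra _ hgA ?_ j₀ fun H => hline ?_)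
    · have ht : Tendsto A (𝓝[≠] 0) (𝓝[≠] 0) := by
        refine tendsto_nhdsWithin_iff.2 ⟨?_, ?_⟩
        · simpa using (A.continuous.tendsto 0).mono_left nhdsWithin_le_nhds
        · filter_upwards [self_mem_nhdsWithin] with z hz
          simpa using hz
      exact ht.eventually hiso
    · filter_upwards [H] with c hc
      have : (Fin.cons c 0 : Fin (n + 1) → ℂ) = c • Pi.single 0 1 := by
        ext i
        refine Fin.cases ?_ (fun i => ?_) i <;> simp
      rwa [Function.comp_apply, this, map_smul, hA] at hc

end Nullstellensatz

/-! ### Coordinates in the radical of the complex Jacobi ideal -/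

section Conditions

variable {n : ℕ}

theorem coordGerm_mem_maxId (i : Fin n) : coordGerm i ∈ maxId n := rfl

theorem isUnit_of_notMem_maxId {F : holoGerms n} (hF : F ∉ maxId n) : IsUnit F := by
  obtain ⟨f, hf, rfl⟩ := exists_germOf_eq F
  exact isUnit_germOf hF

theorem Mu1.coordGerm_mem_radical {F : holoGerms n} (h : Mu1 F) (i : Fin n) :
    coordGerm i ∈ (complexJacobiIdeal F).radical := by
  obtain ⟨m, -, hm⟩ := h
  exact ⟨m, hm i⟩

theorem Mu2.coordGerm_mem_radical {F : holoGerms n} (h : Mu2 F) (i : Fin n) :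
    coordGerm i ∈ (complexJacobiIdeal F).radical := by
  obtain ⟨p, -, hp⟩ := h
  have h1 := hp (Pi.single i p) (by simp)
  rw [Finset.prod_eq_single i (fun j _ hj => by simp [hj]) (by simp), Pi.single_eq_same] at h1
  exact ⟨p, h1⟩

theorem Mu3.coordGerm_mem_radical {F : holoGerms n} (h : Mu3 F) (i : Fin n) :
    coordGerm i ∈ (complexJacobiIdeal F).radical := by
  obtain ⟨p, -, hp⟩ := h
  exact ⟨p, hp (Ideal.pow_mem_pow (coordGerm_mem_maxId i) p)⟩

theorem Mu4.coordGerm_mem_radical {F : holoGerms n} (h : Mu4 F) (i : Fin n) :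
    coordGerm i ∈ (complexJacobiIdeal F).radical := by
  obtain ⟨g, hg, hcrit⟩ := h
  obtain ⟨f, hf, rfl⟩ := exists_germOf_eq F
  have hfg : f =ᶠ[𝓝 0] g := Germ.coe_eq.1 hg
  have han : ∀ j : Fin n, AnalyticAt ℂ (partialFun j f) 0 := fun j =>
    ((ContinuousLinearMap.apply ℂ ℂ (Pi.single j 1 : Fin n → ℂ)).analyticAt _).comp hf.fderiv
  refine isolatedNullstellensatz n (Fin n) (fun j => partialFun j f) han ?_ (coordGerm_mem_maxId i)
  filter_upwards [hcrit, nhdsWithin_le_nhds (hfg.fderiv (𝕜 := ℂ))] with z hz hz'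
  by_contra! H
  refine hz (ContinuousLinearMap.coe_injective (LinearMap.pi_ext' fun j => ?_))
  ext
  have := H j
  rw [partialFun, hz'] at this
  simpa using this

/-- If the quotient is finite-dimensional, then it is Artinian, so that the maximal ideal is the only
prime above the Jacobi ideal. -/
theorem Mu5.coordGerm_mem_radical {F : holoGerms n} (h : Mu5 F) (i : Fin n) :
    coordGerm i ∈ (complexJacobiIdeal F).radical := by
  have hfree : Module.Free ℂ (holoGerms n ⧸ complexJacobiIdeal F) :=
    Module.Free.of_divisionRing ℂ _
  have hfin : Module.Finite ℂ (holoGerms n ⧸ complexJacobiIdeal F) :=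
    Module.rank_lt_aleph0_iff.1 h
  rw [Ideal.radical_eq_sInf, Ideal.mem_sInf]
  rintro P ⟨hle, hP⟩
  have hfinP : Module.Finite ℂ (holoGerms n ⧸ P) :=
    Module.Finite.of_surjective (Ideal.Quotient.factorₐ ℂ hle).toLinearMap
      (Ideal.Quotient.factor_surjective hle)
  have hart : IsArtinianRing (holoGerms n ⧸ P) := IsArtinianRing.of_finite ℂ _
  have hmax : P.IsMaximal := Ideal.Quotient.maximal_of_isField _
    (IsArtinianRing.isField_of_isDomain (holoGerms n ⧸ P))
  have hPm : P ≤ maxId n := fun G hG => by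
    by_contra hG'
    exact hP.ne_top (P.eq_top_of_isUnit_mem hG (isUnit_of_notMem_maxId hG'))
  have hne : maxId n ≠ ⊤ := RingHom.ker_ne_top _
  rw [hmax.eq_of_le hne hPm]
  exact coordGerm_mem_maxId i

end Conditions

/-! ### Hadamard's lemma -/

section Hadamard

/-- Differentiation under the integral sign over `[0, 1]`. -/
theorem hasFDerivAt_integral_param {E F : Type*} [NormedAddCommGroup E]
    [NormedSpace ℝ E] [FiniteDimensional ℝ E] [NormedAddCommGroup F] [NormedSpace ℝ F]
    {φ : E → ℝ → F} (hφ : ContDiff ℝ 1 (Function.uncurry φ)) (x₀ : E) :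
    HasFDerivAt (fun x => ∫ t in (0 : ℝ)..1, φ x t)
      (∫ t in (0 : ℝ)..1, fderiv ℝ (fun x => φ x t) x₀) x₀ := by
  have hφ' : Continuous fun p : E × ℝ => fderiv ℝ (fun x => φ x p.2) p.1 :=
    ContDiff.continuous (n := 0) <| ContDiff.fderiv (m := 1) (n := 0)
      (f := fun (p : E × ℝ) (x : E) => φ x p.2)
      (hφ.comp (contDiff_snd.prodMk (contDiff_snd.comp contDiff_fst))) contDiff_fst (by simp)
  have hK : IsCompact (Metric.closedBall x₀ 1 ×ˢ Set.Icc (0 : ℝ) 1) :=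
    (isCompact_closedBall x₀ 1).prod isCompact_Icc
  obtain ⟨C, hC⟩ := hK.exists_bound_of_continuousOn hφ'.continuousOn
  refine intervalIntegral.hasFDerivAt_integral_of_dominated_of_fderiv_le (bound := fun _ => C)
    (F' := fun x t => fderiv ℝ (fun x => φ x t) x)
    (Metric.ball_mem_nhds x₀ one_pos) (Eventually.of_forall fun x => ?_) ?_ ?_ ?_ ?_ ?_
  · exact (hφ.continuous.comp (by fun_prop : Continuous fun t : ℝ => (x, t))).aestronglyMeasurable
  · exact (hφ.continuous.comp
      (by fun_prop : Continuous fun t : ℝ => (x₀, t))).intervalIntegrable _ _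
  · exact (hφ'.comp (by fun_prop : Continuous fun t : ℝ => (x₀, t))).aestronglyMeasurable
  · refine Eventually.of_forall fun t ht x hx => hC (x, t) ⟨Metric.ball_subset_closedBall hx, ?_⟩
    rw [Set.uIoc_of_le zero_le_one] at ht
    exact Set.Ioc_subset_Icc_self ht
  · exact intervalIntegrable_const
  · refine Eventually.of_forall fun t _ x _ => ?_
    have h1 : ContDiff ℝ 1 fun x => φ x t := hφ.comp (contDiff_id.prodMk contDiff_const)
    exact (h1.differentiable one_ne_zero).differentiableAt.hasFDerivAt

theorem contDiff_integral_param_nat {E : Type} [NormedAddCommGroup E] [NormedSpace ℝ E]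
    [FiniteDimensional ℝ E] (k : ℕ) : ∀ {F : Type} [NormedAddCommGroup F] [NormedSpace ℝ F]
    {φ : E → ℝ → F}, ContDiff ℝ ∞ (Function.uncurry φ) →
      ContDiff ℝ k fun x => ∫ t in (0 : ℝ)..1, φ x t := by
  induction k with
  | zero =>
    intro F _ _ φ hφ
    refine contDiff_zero.2 (continuous_iff_continuousAt.2 fun x => ?_)
    exact (hasFDerivAt_integral_param (hφ.of_le (by norm_num)) x).continuousAt
  | succ k ih =>
    intro F _ _ φ hφ
    have h1 : ∀ x, HasFDerivAt _ _ x := hasFDerivAt_integral_param (hφ.of_le (by norm_num))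
    push_cast
    refine contDiff_succ_iff_hasFDerivAt.2 ⟨_, ih (φ := fun x t => fderiv ℝ (fun x => φ x t) x) ?_, h1⟩
    exact ContDiff.fderiv (n := ∞) (m := ∞) (f := fun (p : E × ℝ) (x : E) => φ x p.2)
      (hφ.comp (contDiff_snd.prodMk (contDiff_snd.comp contDiff_fst))) contDiff_fst (by simp)

theorem contDiff_integral_param {E F : Type} [NormedAddCommGroup E] [NormedSpace ℝ E]
    [FiniteDimensional ℝ E] [NormedAddCommGroup F] [NormedSpace ℝ F] {φ : E → ℝ → F}
    (hφ : ContDiff ℝ ∞ (Function.uncurry φ)) :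
    ContDiff ℝ ∞ fun x => ∫ t in (0 : ℝ)..1, φ x t :=
  contDiff_infty.2 fun k => contDiff_integral_param_nat k hφ

/-- Hadamard's lemma. -/
theorem exists_hadamard {n : ℕ} {g : (Fin n → ℝ) → ℝ} (hg : ContDiff ℝ ∞ g) :
    ∃ h : Fin n → (Fin n → ℝ) → ℝ, (∀ i, ContDiff ℝ ∞ (h i)) ∧
      ∀ x, g x = g 0 + ∑ i, x i * h i x := by
  have hφ : ∀ i : Fin n, ContDiff ℝ ∞ (Function.uncurry fun (x : Fin n → ℝ) (t : ℝ) =>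
      fderiv ℝ g (t • x) (Pi.single i 1)) := fun i =>
    ((hg.fderiv_right (m := ∞) (by simp)).comp (contDiff_snd.smul contDiff_fst)).clm_apply
      contDiff_const
  refine ⟨fun i x => ∫ t in (0 : ℝ)..1, fderiv ℝ g (t • x) (Pi.single i 1),
    fun i => contDiff_integral_param (hφ i), fun x => ?_⟩
  have hcont : ∀ i : Fin n, Continuous fun t : ℝ => fderiv ℝ g (t • x) (Pi.single i 1) := fun i =>
    (hφ i).continuous.comp (by fun_prop : Continuous fun t : ℝ => (x, t))
  have hx : x = ∑ i, x i • (Pi.single i 1 : Fin n → ℝ) := by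
    ext j; simp [Finset.sum_apply, Pi.single_apply]
  have hsum : ∀ t : ℝ, fderiv ℝ g (t • x) x =
      ∑ i, x i * fderiv ℝ g (t • x) (Pi.single i 1) := fun t => by
    generalize fderiv ℝ g (t • x) = L
    conv_lhs => rw [hx]
    simp
  have hder : ∀ t ∈ Set.uIcc (0 : ℝ) 1,
      HasDerivAt (fun t : ℝ => g (t • x)) (∑ i, x i * fderiv ℝ g (t • x) (Pi.single i 1)) t := by
    intro t _
    have h1 : HasDerivAt (fun t : ℝ => t • x) x t := by
      simpa using (hasDerivAt_id t).smul_const x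
    rw [← hsum]
    exact ((hg.differentiable (by simp)).differentiableAt.hasFDerivAt).comp_hasDerivAt t h1
  have hci : ∀ i : Fin n, Continuous fun t : ℝ => x i * fderiv ℝ g (t • x) (Pi.single i 1) :=
    fun i => continuous_const.mul (hcont i)
  have hint := intervalIntegral.integral_eq_sub_of_hasDerivAt hder
    ((continuous_finsetSum _ fun i _ => hci i).intervalIntegrable _ _)
  rw [intervalIntegral.integral_finsetSum fun i _ => (hci i).intervalIntegrable _ _] at hint
  simp only [intervalIntegral.integral_const_mul, one_smul, zero_smul] at hint
  linarith

end Hadamard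

/-! ### Smooth germs -/

section Real

variable {n : ℕ}

/-- The germ of the coordinate function `x_i` on `ℝⁿ`. -/
def realCoordGerm (i : Fin n) : smoothGerms n :=
  ⟨((fun x => x i : (Fin n → ℝ) → ℝ) : Germ _ _), fun x => x i,
    Eventually.of_forall fun _ =>
      (ContinuousLinearMap.proj (R := ℝ) (φ := fun _ : Fin n => ℝ) i).contDiff.contDiffAt, rfl⟩

/-- Hadamard's lemma for germs. -/
theorem smoothGerm_hadamard (f : smoothGerms n) :
    ∃ c : ℝ, ∃ h : Fin n → smoothGerms n,
      f = algebraMap ℝ (smoothGerms n) c + ∑ i, realCoordGerm i * h i := by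
  obtain ⟨_, hf⟩ := f
  obtain ⟨g, hg, rfl⟩ := (mem_smoothGerms_iff _).1 hf
  obtain ⟨h, hh, hgh⟩ := exists_hadamard hg
  refine ⟨g 0, fun i => ⟨h i, h i, Eventually.of_forall fun _ => (hh i).contDiffAt, rfl⟩, ?_⟩
  refine Subtype.ext ?_
  rw [AddMemClass.coe_add, AddSubmonoidClass.coe_finsetSum]
  have h1 := map_sum (Germ.coeRingHom (R := ℝ) (𝓝 (0 : Fin n → ℝ)))
    (fun (i : Fin n) (x : Fin n → ℝ) => x i * h i x) Finset.univ
  refine Eq.trans (b := algebraMap ℝ (Germ (𝓝 (0 : Fin n → ℝ)) ℝ) (g 0) + _) ?_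
    (congrArg _ h1)
  rw [algebraMap_germ]
  exact Germ.coe_eq.2 (Eventually.of_forall fun x => by simpa [Finset.sum_apply] using hgh x)

/-- An algebra is finite if it is spanned by the scalars modulo an ideal generated by finitely many
nilpotent elements. -/
theorem finite_of_nilpotent_generators {k A : Type*} [Field k] [CommRing A] [Algebra k A]
    (x : Fin n → A) (hx : ∀ i, IsNilpotent (x i))
    (hstep : ∀ a : A, ∃ c : k, ∃ h : Fin n → A, a = algebraMap k A c + ∑ i, x i * h i) :
    Module.Finite k A := by
  let B := Algebra.adjoin k (Set.range x)
  have hxB : ∀ i, x i ∈ B := fun i => Algebra.subset_adjoin ⟨i, rfl⟩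
  let I := Ideal.span (Set.range x)
  have hI : IsNilpotent I := by
    refine (Ideal.FG.isNilpotent_iff_le_nilradical (Submodule.fg_span (Set.finite_range x))).2 ?_
    exact Ideal.span_le.2 (by rintro _ ⟨i, rfl⟩; exact hx i)
  have hpow : ∀ N : ℕ, ∀ a : A, ∃ b ∈ B, a - b ∈ I ^ N := by
    intro N
    induction N with
    | zero => exact fun a => ⟨0, B.zero_mem, by simp⟩
    | succ N ih =>
      intro a
      obtain ⟨c, h, rfl⟩ := hstep a
      choose b' hb' hh using fun i => ih (h i)
      refine ⟨algebraMap k A c + ∑ i, x i * b' i,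
        B.add_mem (B.algebraMap_mem c) (B.sum_mem fun i _ => B.mul_mem (hxB i) (hb' i)), ?_⟩
      rw [add_sub_add_left_eq_sub, ← Finset.sum_sub_distrib]
      refine Ideal.sum_mem _ fun i _ => ?_
      rw [← mul_sub, pow_succ']
      exact Ideal.mul_mem_mul (Ideal.subset_span ⟨i, rfl⟩) (hh i)
  have htop : B = ⊤ := by
    refine eq_top_iff.2 fun a _ => ?_
    obtain ⟨N, hN⟩ := hI
    obtain ⟨b, hb, hab⟩ := hpow N a
    rw [hN, Ideal.zero_eq_bot, Ideal.mem_bot, sub_eq_zero] at hab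
    exact hab ▸ hb
  have hfg : B.toSubmodule.FG := fg_adjoin_of_finite (Set.finite_range x) (by
    rintro _ ⟨i, rfl⟩
    obtain ⟨N, hN⟩ := hx i
    exact ⟨Polynomial.X ^ N, Polynomial.monic_X_pow N, by simp [hN]⟩)
  rw [htop, Algebra.top_toSubmodule] at hfg
  exact ⟨hfg⟩

theorem finite_quotient_of_coord_mem_radical {J : Ideal (smoothGerms n)}
    (hJ : ∀ i, realCoordGerm i ∈ J.radical) : Module.Finite ℝ (smoothGerms n ⧸ J) := by
  refine finite_of_nilpotent_generators (fun i => Ideal.Quotient.mk J (realCoordGerm i))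
    (fun i => ?_) fun a => ?_
  · obtain ⟨N, hN⟩ := hJ i
    exact ⟨N, (map_pow (Ideal.Quotient.mk J) _ N).symm.trans (Ideal.Quotient.eq_zero_iff_mem.2 hN)⟩
  · obtain ⟨f, rfl⟩ := Ideal.Quotient.mk_surjective a
    obtain ⟨c, h, hf⟩ := smoothGerm_hadamard f
    refine ⟨c, fun i => Ideal.Quotient.mk J (h i), ?_⟩
    conv_lhs => rw [hf]
    rw [map_add, map_sum]
    simp only [map_mul]
    rfl

/-- The inclusion of `ℝⁿ` into `ℂⁿ`. -/
def ofRealPi (n : ℕ) : (Fin n → ℝ) →L[ℝ] (Fin n → ℂ) :=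
  ContinuousLinearMap.pi fun i => Complex.ofRealCLM.comp (ContinuousLinearMap.proj i)

theorem ofRealPi_apply (x : Fin n → ℝ) : ofRealPi n x = fun i => (x i : ℂ) := rfl

theorem tendsto_ofRealPi : Tendsto (ofRealPi n) (𝓝 0) (𝓝 0) := by
  simpa using (ofRealPi n).continuous.tendsto 0

theorem eventually_contDiffAt_re_comp {a : (Fin n → ℂ) → ℂ} (ha : AnalyticAt ℂ a 0) :
    ∀ᶠ x : Fin n → ℝ in 𝓝 0, ContDiffAt ℝ ∞ (fun x => (a (ofRealPi n x)).re) x := by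
  filter_upwards [tendsto_ofRealPi.eventually ha.eventually_analyticAt] with x hx
  exact Complex.reCLM.contDiff.contDiffAt.comp x
    ((hx.contDiffAt.restrict_scalars ℝ).comp x (ofRealPi n).contDiff.contDiffAt)

/-- On `ℝⁿ` the partial derivatives of the complexification are those of the real germ. -/
theorem eventually_partialFun_eq {F : (Fin n → ℂ) → ℂ} {g : (Fin n → ℝ) → ℝ}
    (hF : AnalyticAt ℂ F 0) (hg : ∀ᶠ x in 𝓝 0, ContDiffAt ℝ ∞ g x)
    (hFg : ∀ᶠ x : Fin n → ℝ in 𝓝 0, F (ofRealPi n x) = (g x : ℂ)) (i : Fin n) :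
    ∀ᶠ x : Fin n → ℝ in 𝓝 0, partialFun i F (ofRealPi n x) = ((partialFun i g x : ℝ) : ℂ) := by
  filter_upwards [tendsto_ofRealPi.eventually hF.eventually_analyticAt, hg,
    hFg.eventually_nhds] with x hFx hgx hx
  have h1 : HasFDerivAt (fun y => F (ofRealPi n y))
      (((fderiv ℂ F (ofRealPi n x)).restrictScalars ℝ).comp (ofRealPi n)) x :=
    (hFx.differentiableAt.hasFDerivAt.restrictScalars ℝ).comp x (ofRealPi n).hasFDerivAt
  have h2 : HasFDerivAt (fun y => (g y : ℂ)) (Complex.ofRealCLM.comp (fderiv ℝ g x)) x :=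
    Complex.ofRealCLM.hasFDerivAt.comp x (hgx.differentiableAt (by simp)).hasFDerivAt
  have hx' : (fun y => F (ofRealPi n y)) =ᶠ[𝓝 x] fun y => (g y : ℂ) := hx
  have h3 := congrArg (· (Pi.single i 1)) (h1.unique (h2.congr_of_eventuallyEq hx'))
  have h4 : ofRealPi n (Pi.single i 1) = Pi.single i 1 := by
    ext j
    simp [ofRealPi_apply, Pi.single_apply, apply_ite]
  simpa [h4, partialFun] using h3

/-- If a power of `z_i` lies in the complex Jacobi ideal, then the real parts of the coefficients
put the same power of `x_i` into the real one. -/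
theorem realCoordGerm_mem_radical {f : smoothGerms n} (hf : IsAnalyticGerm f) {i : Fin n}
    (h : coordGerm i ∈ (complexJacobiIdeal hf.complexification).radical) :
    realCoordGerm i ∈ (realJacobiIdeal f).radical := by
  obtain ⟨m, hm⟩ := h
  obtain ⟨A, hA⟩ := Ideal.mem_span_range_iff_exists_fun.1 hm
  choose a ha haA using fun j => exists_germOf_eq (A j)
  obtain ⟨F, hF, hFf⟩ := exists_germOf_eq hf.complexification
  obtain ⟨g, hg, hgf⟩ := f.2
  have hFg := hf.complexification_ofReal (congrArg Subtype.val hFf).symm hgf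
  have hsum : ∀ᶠ z : Fin n → ℂ in 𝓝 0, ∑ j, a j z * partialFun j F z = z i ^ m := by
    have hp : ∀ j : Fin n, AnalyticAt ℂ (partialFun j F) 0 := fun j =>
      ((ContinuousLinearMap.apply ℂ ℂ (Pi.single j 1 : Fin n → ℂ)).analyticAt _).comp hF.fderiv
    have h1 := germOf_sum Finset.univ (fun j z => a j z * partialFun j F z)
      fun j => (ha j).mul (hp j)
    have h2 : ∑ j, germOf (fun z => a j z * partialFun j F z) ((ha j).mul (hp j)) =
        coordGerm i ^ m := by
      rw [← hA, ← hFf]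
      refine Finset.sum_congr rfl fun j _ => ?_
      rw [← haA]
      rfl
    exact Germ.coe_eq.1 (congrArg Subtype.val (h1.trans h2))
  refine ⟨m, Ideal.mem_span_range_iff_exists_fun.2
    ⟨fun j => ⟨_, _, eventually_contDiffAt_re_comp (ha j), rfl⟩, Subtype.ext ?_⟩⟩
  rw [AddSubmonoidClass.coe_finsetSum]
  have h1 := map_sum (Germ.coeRingHom (R := ℝ) (𝓝 (0 : Fin n → ℝ)))
    (fun (j : Fin n) (x : Fin n → ℝ) => (a j (ofRealPi n x)).re * partialFun j g x) Finset.univ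
  have h2 : ∀ j : Fin n, (smoothPartial j f : Germ (𝓝 (0 : Fin n → ℝ)) ℝ) =
      (partialFun j g : Germ _ _) := fun j => congrArg (germPartial j) hgf
  simp only [MulMemClass.coe_mul, h2]
  refine h1.symm.trans (Germ.coe_eq.2 ?_)
  filter_upwards [tendsto_ofRealPi.eventually hsum,
    eventually_all.2 fun j => eventually_partialFun_eq hF hg hFg j] with x hx1 hx2
  have h3 := congrArg Complex.re hx1
  simp only [hx2, Complex.re_sum, Complex.re_mul_ofReal] at h3
  rw [Finset.sum_apply, h3, ofRealPi_apply, ← Complex.ofReal_pow, Complex.ofReal_re]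
  rfl

end Real

end GermMilnor

end

theorem mainTheorem8 (n : ℕ) (f : GermMilnor.smoothGerms n) (hf : GermMilnor.IsAnalyticGerm f)
    (hμ : GermMilnor.Mu1 hf.complexification ∨ GermMilnor.Mu2 hf.complexification ∨
      GermMilnor.Mu3 hf.complexification ∨ GermMilnor.Mu4 hf.complexification ∨
      GermMilnor.Mu5 hf.complexification) :
    GermMilnor.realMilnorNumber f < Cardinal.aleph0 := by
  have h : ∀ i, GermMilnor.coordGerm i ∈
      (GermMilnor.complexJacobiIdeal hf.complexification).radical := fun i => by
    rcases hμ with h | h | h | h | h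
    exacts [h.coordGerm_mem_radical i, h.coordGerm_mem_radical i, h.coordGerm_mem_radical i,
      h.coordGerm_mem_radical i, h.coordGerm_mem_radical i]
  have := GermMilnor.finite_quotient_of_coord_mem_radical
    fun i => GermMilnor.realCoordGerm_mem_radical hf (h i)
  exact Module.rank_lt_aleph0 ℝ _
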